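/- **Setting.** For a Polish space $E$ let $\mathcal P(E)$ be the Polish space of Borel probability measures on $E$ with the topology of weak convergence (denoted $\Rightarrow$) and its Borel $\sigma$-field. Let $S$ and $\Omega$ be Polish spaces, $r\in\mathcal P(\Omega)$, and let $\kappa:\Omega\to\{0,1,2,\dots,\infty\}$ be measurable. Put $\Omega_k=\{\omega:\kappa(\omega)=k\}$, and let $\gamma$ assign to each $\omega\in\Omega$ a map $\gamma[\omega]:S^{\kappa(\omega)}\to S$ such that $(\omega,x)\mapsto\gamma[\omega](x)$ is jointly measurable on $\Omega_k\times S^k$ for each $k\in\{0,1,\dots,\infty\}$ ($S^\infty$ is the space of infinite sequences, $S^0$ is a singleton). For a measurable $g:S^k\to S$ and $\mu_1,\mu_2,\ldots\in\mathcal P(S)$ ($k$ measures), let $\check g(\mu_1,\mu_2,\dots)\in\mathcal P(S)$ be the image of $\mu_1\otimes\mu_2\otimes\cdots$ under $g$, and let $T_g(\mu)=\check g(\mu,\mu,\dots)$. Define $$T(\mu)=\int_\Omega r(d\omega)\,T_{\gamma[\omega]}(\mu)\quad(\mu\in\mathcal P(S)),\qquad \check T(\rho)=\int_\Omega r(d\omega)\,T_{\check\gamma[\omega]}(\rho)\quad(\rho\in\mathcal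 P(\mathcal P(S))),$$ where $\check\gamma[\omega]:\mathcal P(S)^{\kappa(\omega)}\to\mathcal P(S)$ is the map $\check g$ for $g=\gamma[\omega]$. The first moment measure of $\rho\in\mathcal P(\mathcal P(S))$ is $\rho^{(1)}=\int\rho(d\xi)\,\xi\in\mathcal P(S)$. For $\mu\in\mathcal P(S)$ let $\overline\mu\in\mathcal P(\mathcal P(S))$ be the law of $\delta_X$, where $X$ has law $\mu$. Fix $d\in\{1,2,\dots,\infty\}$ with $\kappa(\omega)\le d$ for all $\omega$, and let $\mathbb T$ be the set of finite words over the alphabet $\{1,\dots,d\}$ ($\{1,2,\dots\}$ if $d=\infty$), with $\varnothing$ the empty word and $|\mathbf i|$ the length of $\mathbf i$. Let $\mu\in\mathcal P(S)$ satisfy $T(\mu)=\mu$. A *recursive tree process* (RTP) corresponding to $\gamma$ and $\mu$ is a family $(\omega_{\mathbf i},X_{\mathbf i})_{\mathbf i\in\mathbb T}$ of $\Omega\times S$-valued random variables on a probability space such that (a) the $\omega_{\mathbf i}$ are i.i.d. with law $r$; (b) for each $t\ge1$, the $(X_{\mathbf i})_{|\mathbf i|=t}$ are i.i.d. with law $\mu$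 and independent of $(\omega_{\mathbf i})_{|\mathbf i|<t}$; (c) for each $\mathbf i\in\mathbb T$, almost surely $X_{\mathbf i}=\gamma[\omega_{\mathbf i}](X_{\mathbf i1},\dots,X_{\mathbf i\kappa(\omega_{\mathbf i})})$ (all of $X_{\mathbf i1},X_{\mathbf i2},\dots$ if $\kappa(\omega_{\mathbf i})=\infty$). It is *endogenous* if $X_\varnothing$ is almost surely equal to a random variable that is measurable with respect to the $\sigma$-field generated by $(\omega_{\mathbf i})_{\mathbf i\in\mathbb T}$. **Theorem (The higher-level RDE).** Let $\mu\in\mathcal P(S)$ be a solution of $T(\mu)=\mu$. Then an RTP corresponding to $\gamma$ and $\mu$ exists, and there is a (necessarily unique) $\underline\mu\in\mathcal P(\mathcal P(S))$ with $\check T^t(\delta_\mu)\Rightarrow\underline\mu$ as $t\to\infty$; moreover $\underline\mu^{(1)}=\mu$. For every RTP corresponding to $\gamma$ and $\mu$, the following statements are equivalent. 1. The RTP is endogenous. 2. $\underline\mu=\overline\mu$. 3. $\check T^t(\rho)\Rightarrow\overline\mu$ as $t\to\infty$ for every $\rho\in\mathcal P(\mathcal P(S))$ with $\rho^{(1)}=\mu$.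 -/

import Mathlib

open MeasureTheory ProbabilityTheory Filter Topology

/-- A topology `σ` with a countable subbasis of measurable sets has measurable open sets. -/
theorem isOpen_measurableSet_of_countable_subbasis {α : Type*} [MeasurableSpace α]
    {C : Set (Set α)} (hC : C.Countable) (hm : ∀ U ∈ C, MeasurableSet U) {U : Set α}
    (hU : IsOpen[TopologicalSpace.generateFrom C] U) : MeasurableSet U := by
  let σ : TopologicalSpace α := TopologicalSpace.generateFrom C
  have : SecondCountableTopology α := ⟨⟨_, hC, rfl⟩⟩
  have h : @borel α σ ≤ (inferInstance : MeasurableSpace α) := by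
    rw [borel_eq_generateFrom_of_subbasis (s := C) rfl]
    exact MeasurableSpace.generateFrom_le hm
  exact h _ (MeasurableSpace.measurableSet_generateFrom hU)

/-- If the identity is continuous at every point from the topology generated by the countable
family `C`, then the open sets are open for that topology. -/
theorem isOpen_generateFrom_of_tendsto {α : Type*} [τ : TopologicalSpace α]
    {C : Set (Set α)} (hC : C.Countable)
    (h : ∀ (a : α) (L : Filter α), L.IsCountablyGenerated →
      (∀ U ∈ C, a ∈ U → U ∈ L) → Tendsto id L (𝓝 a)) {U : Set α}
    (hU : IsOpen U) : IsOpen[TopologicalSpace.generateFrom C] U := by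
  rw [@isOpen_iff_mem_nhds _ (TopologicalSpace.generateFrom C)]
  intro a ha
  have hcg : (@nhds α (TopologicalSpace.generateFrom C) a).IsCountablyGenerated := by
    let σ : TopologicalSpace α := TopologicalSpace.generateFrom C
    have : @SecondCountableTopology α σ := ⟨⟨_, hC, rfl⟩⟩
    exact @FirstCountableTopology.nhds_generated_countable α σ inferInstance a
  refine h a _ hcg (fun V hV haV => ?_) (hU.mem_nhds ha)
  exact @IsOpen.mem_nhds α (TopologicalSpace.generateFrom C) _ _
    (TopologicalSpace.isOpen_generateFrom_of_mem hV) haV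

/-- On a separable metrizable space, the `σ`-algebra that Mathlib puts on the space of probability
measures (generated by the evaluations `μ ↦ μ A`) is the Borel `σ`-algebra of the topology of weak
convergence. -/
instance ProbabilityMeasure.instBorelSpaceWeak {S : Type*} [TopologicalSpace S]
    [SecondCountableTopology S] [TopologicalSpace.PseudoMetrizableSpace S] [MeasurableSpace S]
    [BorelSpace S] : BorelSpace (ProbabilityMeasure S) := by
  let : PseudoMetricSpace S := TopologicalSpace.pseudoMetrizableSpacePseudoMetric S
  constructor
  apply le_antisymm
  · -- evaluations are Borel measurable
    have key : @Measurable (ProbabilityMeasure S) (Measure S) (borel _) _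
        (fun μ : ProbabilityMeasure S => (μ : Measure S)) := by
      let : MeasurableSpace (ProbabilityMeasure S) := borel _
      have : BorelSpace (ProbabilityMeasure S) := ⟨rfl⟩
      refine Measurable.measure_of_isPiSystem_of_isProbabilityMeasure
        (BorelSpace.measurable_eq (α := S)) isPiSystem_isOpen ?_
      intro G hG
      apply measurable_of_Ioi
      intro c
      apply IsOpen.measurableSet
      rw [isOpen_iff_mem_nhds]
      intro μ hμ
      have h1 : (μ : Measure S) G ≤
          (𝓝 μ).liminf (fun ν : ProbabilityMeasure S => (ν : Measure S) G) :=
        ProbabilityMeasure.le_liminf_measure_open_of_tendsto tendsto_id hG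
      exact eventually_lt_of_lt_liminf (lt_of_lt_of_le hμ h1)
    intro s hs
    obtain ⟨t, ht, rfl⟩ := hs
    exact key ht
  · -- weakly open sets are measurable for the evaluation `σ`-algebra
    have hB := TopologicalSpace.isBasis_countableBasis S
    let sub : Finset (Set S) × ℚ → Set (ProbabilityMeasure S) :=
      fun i => {ν | (i.2 : ℝ) < ν (⋃ t ∈ i.1, t)}
    let J : Set (Finset (Set S) × ℚ) :=
      {T : Finset (Set S) | (T : Set (Set S)) ⊆ TopologicalSpace.countableBasis S} ×ˢ Set.univ
    have hJ : J.Countable := by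
      refine Set.Countable.prod ?_ Set.countable_univ
      have h1 := Set.countable_ofPred_finite_subset
        (TopologicalSpace.countable_countableBasis S)
      have h2 := h1.preimage (f := fun T : Finset (Set S) => (T : Set (Set S)))
        Finset.coe_injective
      exact h2.mono fun T hT => And.intro T.finite_toSet hT
    apply MeasurableSpace.generateFrom_le
    intro U hU
    refine isOpen_measurableSet_of_countable_subbasis (hJ.image sub) ?_
      (isOpen_generateFrom_of_tendsto (hJ.image sub) ?_ hU)
    · rintro _ ⟨⟨T, q⟩, hT, rfl⟩
      have hmeas : MeasurableSet (⋃ t ∈ T, t) :=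
        Finset.measurableSet_biUnion _ fun t ht => (hB.isOpen (hT.1 ht)).measurableSet
      have h1 : Measurable (fun ν : ProbabilityMeasure S => (ν : Measure S) (⋃ t ∈ T, t)) :=
        (Measure.measurable_coe hmeas).comp measurable_subtype_coe
      exact measurableSet_lt measurable_const h1.ennreal_toReal
    · intro μ L hL hmem
      rcases L.eq_or_neBot with rfl | hne
      · simp
      apply tendsto_of_forall_isOpen_le_liminf
      intro G hG
      refine (le_liminf_iff (isCoboundedUnder_ge_of_le (x := 1) _ (by simp))
        (by isBoundedDefault)).2 (fun r hr ↦ ?_)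
      obtain ⟨T, hTB, hrT, hTG⟩ := μ.exists_lt_measure_biUnion_of_isOpen
        (S := TopologicalSpace.countableBasis S)
        (fun u hu x hx => by
          obtain ⟨v, hv, hxv, hvu⟩ := hB.exists_subset_of_mem_open hx hu
          exact ⟨v, hv, (hB.isOpen hv).mem_nhds hxv, hvu⟩) hG hr
      obtain ⟨q, hq1, hq2⟩ := exists_rat_btwn (NNReal.coe_lt_coe.2 hrT)
      filter_upwards [hmem _ ⟨(T, q), ⟨fun t ht => hTB t ht, trivial⟩, rfl⟩ hq2] with ν hν
      exact NNReal.coe_lt_coe.1 (hq1.trans (lt_of_lt_of_le hν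
        (NNReal.coe_le_coe.2 (ProbabilityMeasure.apply_mono _ hTG))))

/-- The index set `{0, …, k - 1}` of a sequence of length `k ∈ {0, 1, 2, …, ∞}` (it is `ℕ` for
`k = ∞`); thus `ArgIndex k → S` is the space `S ^ k`. -/
abbrev ArgIndex (k : ℕ∞) : Type := {j : ℕ // (j : ℕ∞) < k}

/-- The product measure depends measurably on its factors. -/
theorem measurable_infinitePi_probabilityMeasure {ι S : Type*} [MeasurableSpace S] :
    Measurable (fun m : ι → ProbabilityMeasure S =>
      Measure.infinitePi (fun i => (m i : Measure S))) := by
  refine Measurable.measure_of_isPiSystem_of_isProbabilityMeasure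
    (generateFrom_squareCylinders (α := fun _ : ι => S)).symm
    (isPiSystem_squareCylinders (fun _ => MeasurableSpace.isPiSystem_measurableSet)
      (fun _ => MeasurableSet.univ)) ?_
  rintro _ ⟨s, t, ht, rfl⟩
  have h : ∀ m : ι → ProbabilityMeasure S,
      Measure.infinitePi (fun i => (m i : Measure S)) ((s : Set ι).pi t) =
        ∏ i ∈ s, (m i : Measure S) (t i) := fun m =>
    Measure.infinitePi_pi _ (fun i _ => ht i trivial)
  simp only [h]
  exact Finset.measurable_fun_prod _ fun i _ =>
    (Measure.measurable_coe (ht i trivial)).comp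
      (measurable_subtype_coe.comp (measurable_pi_apply i))

/-- For measurable `g : S ^ k → S`, the map `𝒫(S) ^ k → 𝒫(S)` that sends `(μ₁, μ₂, …)` to the image
of the product measure `μ₁ ⊗ μ₂ ⊗ ⋯` under `g`. -/
noncomputable def pushProduct {S : Type*} [MeasurableSpace S] {k : ℕ∞}
    (g : (ArgIndex k → S) → S) (hg : Measurable g) (m : ArgIndex k → ProbabilityMeasure S) :
    ProbabilityMeasure S :=
  ⟨(Measure.infinitePi fun j => (m j : Measure S)).map g,
    Measure.isProbabilityMeasure_map hg.aemeasurable⟩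

/-- The data `κ` and `γ`: a measurable arity `κ : Ω → {0, 1, …, ∞}` and, for each `k`, a jointly
measurable map `γ : Ω_k × S ^ k → S` with `Ω_k = {ω | κ ω = k}`. -/
structure RandomMap (Ω S : Type*) [MeasurableSpace Ω] [MeasurableSpace S] where
  /-- the arity `κ` -/
  arity : Ω → ℕ∞
  measurable_arity : Measurable arity
  /-- the maps `γ` on `Ω_k × S ^ k` -/
  toFun : ∀ k : ℕ∞, {ω : Ω // arity ω = k} → (ArgIndex k → S) → S
  measurable_toFun : ∀ k : ℕ∞,
    Measurable (fun p : {ω : Ω // arity ω = k} × (ArgIndex k → S) => toFun k p.1 p.2)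

namespace RandomMap

variable {Ω S : Type*} [MeasurableSpace Ω] [MeasurableSpace S]

theorem measurable_toFun_apply (γ : RandomMap Ω S) (k : ℕ∞) (ω : {ω : Ω // γ.arity ω = k}) :
    Measurable (γ.toFun k ω) :=
  (γ.measurable_toFun k).comp measurable_prodMk_left

/-- The map `γ[ω] : S ^ κ(ω) → S`. -/
def map (γ : RandomMap Ω S) (ω : Ω) : (ArgIndex (γ.arity ω) → S) → S :=
  γ.toFun (γ.arity ω) ⟨ω, rfl⟩

theorem measurable_map (γ : RandomMap Ω S) (ω : Ω) : Measurable (γ.map ω) :=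
  γ.measurable_toFun_apply _ _

/-- The higher-level data `γ̌`, with `γ̌[ω] : 𝒫(S) ^ κ(ω) → 𝒫(S)` the map that sends a sequence of
probability measures to the image of their product under `γ[ω]`. -/
noncomputable def higher (γ : RandomMap Ω S) : RandomMap Ω (ProbabilityMeasure S) where
  arity := γ.arity
  measurable_arity := γ.measurable_arity
  toFun k ω m := pushProduct (γ.toFun k ω) (γ.measurable_toFun_apply k ω) m
  measurable_toFun k := by
    refine Measurable.subtype_mk (Measure.measurable_of_measurable_coe _ fun A hA => ?_)
    let K : Kernel ({ω : Ω // γ.arity ω = k} × (ArgIndex k → ProbabilityMeasure S))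
        (ArgIndex k → S) :=
      ⟨fun p => Measure.infinitePi (fun j => (p.2 j : Measure S)),
        measurable_infinitePi_probabilityMeasure.comp measurable_snd⟩
    have hK : IsMarkovKernel K := ⟨fun p =>
      inferInstanceAs (IsProbabilityMeasure (Measure.infinitePi (fun j => (p.2 j : Measure S))))⟩
    have hT : MeasurableSet {q : ({ω : Ω // γ.arity ω = k} ×
        (ArgIndex k → ProbabilityMeasure S)) × (ArgIndex k → S) | γ.toFun k q.1.1 q.2 ∈ A} :=
      ((γ.measurable_toFun k).comp
        ((measurable_fst.comp measurable_fst).prodMk measurable_snd)) hA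
    have h := Kernel.measurable_kernel_prodMk_left (κ := K) hT
    convert h using 2 with p
    exact Measure.map_apply (γ.measurable_toFun_apply k p.1) hA

/-- The law `T_{γ[ω]}(μ)` of `γ[ω](X₁, X₂, …)` for i.i.d. `X₁, X₂, …` with law `μ`. -/
noncomputable def lawAt (γ : RandomMap Ω S) (μ : ProbabilityMeasure S) (ω : Ω) :
    ProbabilityMeasure S :=
  pushProduct (γ.map ω) (γ.measurable_map ω) fun _ => μ

theorem measurable_lawAt (γ : RandomMap Ω S) (μ : ProbabilityMeasure S) :
    Measurable (γ.lawAt μ) := by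
  intro A hA
  have hk : ∀ k : ℕ∞, MeasurableSet (Subtype.val ''
      {ω : {ω : Ω // γ.arity ω = k} | γ.higher.toFun k ω (fun _ => μ) ∈ A}) := fun k =>
    MeasurableSet.subtype_image (γ.measurable_arity (measurableSet_singleton k))
      (((γ.higher.measurable_toFun k).comp measurable_prodMk_right) hA)
  have : γ.lawAt μ ⁻¹' A = ⋃ k : ℕ∞, Subtype.val ''
      {ω : {ω : Ω // γ.arity ω = k} | γ.higher.toFun k ω (fun _ => μ) ∈ A} := by
    ext ω
    simp only [Set.mem_preimage, Set.mem_iUnion, Set.mem_image]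
    constructor
    · intro h
      exact ⟨γ.arity ω, ⟨ω, rfl⟩, h, rfl⟩
    · rintro ⟨k, ⟨ω', rfl⟩, h, rfl⟩
      exact h
  rw [this]
  exact MeasurableSet.iUnion hk

/-- The map `T(μ) = ∫ r(dω) T_{γ[ω]}(μ)` on `𝒫(S)`. -/
noncomputable def rdeMap (γ : RandomMap Ω S) (r : ProbabilityMeasure Ω)
    (μ : ProbabilityMeasure S) : ProbabilityMeasure S :=
  ⟨(r : Measure Ω).bind fun ω => (γ.lawAt μ ω : Measure S),
    isProbabilityMeasure_bind (measurable_subtype_coe.comp (γ.measurable_lawAt μ)).aemeasurable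
      (Eventually.of_forall fun ω => (γ.lawAt μ ω).2)⟩

/-- The higher-level map `Ť(ρ) = ∫ r(dω) T_{γ̌[ω]}(ρ)` on `𝒫(𝒫(S))`. -/
noncomputable def higherMap (γ : RandomMap Ω S) (r : ProbabilityMeasure Ω) :
    ProbabilityMeasure (ProbabilityMeasure S) → ProbabilityMeasure (ProbabilityMeasure S) :=
  γ.higher.rdeMap r

end RandomMap

/-- The first moment measure `ρ⁽¹⁾ = ∫ ρ(dξ) ξ` of `ρ ∈ 𝒫(𝒫(S))`. -/
noncomputable def firstMoment {S : Type*} [MeasurableSpace S]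
    (ρ : ProbabilityMeasure (ProbabilityMeasure S)) : ProbabilityMeasure S :=
  ⟨(ρ : Measure (ProbabilityMeasure S)).bind fun ξ => (ξ : Measure S),
    isProbabilityMeasure_bind measurable_subtype_coe.aemeasurable
      (Eventually.of_forall fun ξ => ξ.2)⟩

/-- The law `μ̄ ∈ 𝒫(𝒫(S))` of `δ_X`, where `X` has law `μ`. -/
noncomputable def diracLaw {S : Type*} [MeasurableSpace S] (μ : ProbabilityMeasure S) :
    ProbabilityMeasure (ProbabilityMeasure S) :=
  μ.map (f := diracProba) (Measurable.subtype_mk Measure.measurable_dirac).aemeasurable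

/-- The tree `𝕋^d` of finite words over an alphabet with `d ∈ {1, 2, …, ∞}` letters. The root is the
empty word and the children of `i` are the words `i ++ [j]`. -/
abbrev TreeWord (d : ℕ∞) : Type := List (ArgIndex d)

/-- Random variables `(W i, X i)` indexed by the tree `𝕋^d`, on a probability space `(E, P)`, form a
recursive tree process for the map `γ`, the law `r` and the probability measure `μ`.
As usual, equalities between random variables are almost sure. -/
structure IsRecursiveTreeProcess {Ω S E : Type*} [MeasurableSpace Ω] [MeasurableSpace S]
    [MeasurableSpace E] (γ : RandomMap Ω S) (r : ProbabilityMeasure Ω) (d : ℕ∞)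
    (hd : ∀ ω, γ.arity ω ≤ d) (μ : ProbabilityMeasure S) (P : Measure E)
    (W : TreeWord d → E → Ω) (X : TreeWord d → E → S) : Prop where
  measurable_noise : ∀ i, Measurable (W i)
  measurable_state : ∀ i, Measurable (X i)
  /-- the `W i` are i.i.d. with law `r` -/
  indep_noise : iIndepFun W P
  law_noise : ∀ i, P.map (W i) = r
  /-- for `t ≥ 1`, the `X i` with `|i| = t` are i.i.d. with law `μ` -/
  indep_state : ∀ t : ℕ, 1 ≤ t →
    iIndepFun (fun i : {i : TreeWord d // i.length = t} => X i) P
  law_state : ∀ t : ℕ, 1 ≤ t → ∀ i : TreeWord d, i.length = t → P.map (X i) = μ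
  /-- for `t ≥ 1`, the `X i` with `|i| = t` are independent of the `W i` with `|i| < t` -/
  indep_state_noise : ∀ t : ℕ, 1 ≤ t →
    IndepFun (fun e (i : {i : TreeWord d // i.length = t}) => X i e)
      (fun e (i : {i : TreeWord d // i.length < t}) => W i e) P
  /-- `X i = γ[W i](X (i 1), X (i 2), …)` -/
  recursion : ∀ i, ∀ᵐ e ∂P,
    X i e = γ.map (W i e) fun j => X (i ++ [⟨j.1, lt_of_lt_of_le j.2 (hd (W i e))⟩]) e

/-- Endogeny: the state at the root is (almost surely equal to a random variable that is)
measurable with respect to the `σ`-algebra generated by all the `W i`. -/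
def IsEndogenous {Ω S E : Type*} [MeasurableSpace Ω] [MeasurableSpace S] [MeasurableSpace E]
    {d : ℕ∞} (P : Measure E) (W : TreeWord d → E → Ω) (X : TreeWord d → E → S) : Prop :=
  ∃ Y : E → S,
    Measurable[⨆ i : TreeWord d, MeasurableSpace.comap (W i) inferInstance] Y ∧ X [] =ᵐ[P] Y

/-!
Fix a recursive tree process `(W, X)` for `γ`, `r` and `μ`, and let `ξ` be the conditional law of
the state `X ∅` at the root given all the noise `W`. Everything rests on the identification of the
limit `μ'` of `Ťᵗ(δ_μ)` with the law of `ξ`.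

*Convergence.* Given the noise above level `t` only, the states at level `t` are still independent
with law `μ`, so the conditional law `ξ_t` of the root is computed from the noise by evaluating the
higher-level maps `γ̌` along the tree, starting from the constant `μ` at level `t`
(`condExp_root_ae_eq`). Hence `ξ_t` has law `Ťᵗ(δ_μ)` (`map_treeEval`, `map_higher_treeEval`). By
Lévy's upward theorem `ξ_t f → ξ f` in `L¹` for each bounded continuous `f`, and this is enough for
weak convergence of the laws, because open sets of measures are countable unions of sets `{h > 0}`
with `h` Lipschitz in finitely many integrals (`tendsto_law_of_coupling`). So
`Ťᵗ(δ_μ)` converges to the law of `ξ` (`tendsto_iterate_higherMap`), which has first moment `μ`. In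
particular the law of `ξ` is the same for all recursive tree processes.

*Endogeny.* If `X ∅` is a function of the noise, then `ξ = δ_{X ∅}` almost surely and `ξ` has law
`μ̄`. Conversely, if `ξ` has law `μ̄`, then for a bounded injective `f` the variable `f (X ∅)` and
its conditional expectation `ξ f` have the same second moment, hence agree almost surely, and `X ∅` is
recovered from `ξ f` (`isEndogenous_iff_law_rootLaw`).

*Convergence from all starting points.* If `ρ` has first moment `μ`, then so has `Ťᵗ(ρ)`, and by
Jensen's inequality `∫ (ξ f)² Ťᵗ(δ_μ)(dξ) ≤ ∫ (ξ f)² Ťᵗ(ρ)(dξ) ≤ ∫ f² dμ`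
(`sq_integral_iterate_le`). When `Ťᵗ(δ_μ) → μ̄` the left side tends to the right side, so the
variance of `f` under a random measure with law `Ťᵗ(ρ)` tends to zero in mean: it is asymptotically
a point mass, and `Ťᵗ(ρ) → μ̄` (`tendsto_diracLaw_of_sq_le`).

*Existence.* As `T(μ) = μ`, a state with law `μ` can be resolved, with the help of an independent
uniform variable, into noise and independent states of its children (`exists_resolution`). Unfolding
a state with law `μ` at the root in this way gives all levels of the tree at once
(`unfoldTree`, `map_cut_unfoldTree`), without an extension theorem for projective families.
-/

/-! ### Product measures indexed by words -/

section ProductMeasure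

open Measure

/-- Under a product measure indexed by the words over `A`, the coordinate at the root and the
subtrees rooted at the letters are independent, with product laws. -/
theorem infinitePi_map_root_subtrees {A M : Type*} [MeasurableSpace M]
    (m : List A → Measure M) [∀ i, IsProbabilityMeasure (m i)] :
    (infinitePi m).map (fun z => (z [], fun (j : A) (i : List A) => z (j :: i))) =
      (m []).prod (infinitePi fun j => infinitePi fun i => m (j :: i)) := by
  have hind : iIndepFun (fun (i : List A) (z : List A → M) => z i) (infinitePi m) :=
    iIndepFun_infinitePi (X := fun _ x => x) fun _ => measurable_id
  have hpair : IndepFun (fun z : List A → M => z [])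
      (fun (z : List A → M) (p : A × List A) => z (p.1 :: p.2)) (infinitePi m) := by
    have h := indep_iSup_of_disjoint (S := {([] : List A)}) (T := {[]}ᶜ)
      (fun i => (measurable_pi_apply i).comap_le) hind disjoint_compl_right
    refine indep_of_indep_of_le_left (indep_of_indep_of_le_right h ?_) ?_
    · simp only [MeasurableSpace.pi, MeasurableSpace.comap_iSup, MeasurableSpace.comap_comp]
      refine iSup_le fun p => ?_
      exact le_iSup₂_of_le (f := fun (i : List A) (_ : i ∈ ({[]}ᶜ : Set (List A))) =>
        MeasurableSpace.comap (fun z : List A → M => z i) inferInstance)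
        (p.1 :: p.2) (by simp) le_rfl
    · exact le_iSup₂_of_le (f := fun (i : List A) (_ : i ∈ ({[]} : Set (List A))) =>
        MeasurableSpace.comap (fun z : List A → M => z i) inferInstance) [] rfl le_rfl
  have hinj : Function.Injective (fun p : A × List A => p.1 :: p.2) := by
    rintro ⟨j, i⟩ ⟨j', i'⟩ h
    simpa using h
  have h1 := hpair.map_prod_eq_prod_map_map
    (Measurable.aemeasurable (by fun_prop)) (Measurable.aemeasurable (by fun_prop))
  rw [infinitePi_map_eval, map_infinitePi_infinitePi_of_inj hinj] at h1
  have h2 := infinitePi_map_curry (fun (j : A) (i : List A) => m (j :: i))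
  rw [← h2]
  conv_rhs => rw [← Measure.map_id (μ := m [])]
  rw [Measure.map_prod_map _ _ measurable_id (MeasurableEquiv.measurable _), ← h1,
    Measure.map_map (measurable_id.prodMap (MeasurableEquiv.measurable _)) (by fun_prop)]
  rfl

/-- The inverse of `infinitePi_map_root_subtrees`: a product measure indexed by words is glued from
its root coordinate and its subtrees. -/
theorem infinitePi_eq_map_root_subtrees {A M : Type*} [MeasurableSpace M]
    (m : List A → Measure M) [∀ i, IsProbabilityMeasure (m i)] :
    ((m []).prod (infinitePi fun j => infinitePi fun i => m (j :: i))).map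
      (fun p (i : List A) => i.casesOn p.1 fun j i => p.2 j i) = infinitePi m := by
  rw [← infinitePi_map_root_subtrees, Measure.map_map ?_ (by fun_prop)]
  · convert Measure.map_id using 2
    ext z i
    cases i <;> rfl
  · refine measurable_pi_lambda _ fun i => ?_
    cases i
    · exact measurable_fst
    · exact (measurable_pi_apply _).comp ((measurable_pi_apply _).comp measurable_snd)

/-- A product of products of two probability measures is, after separating the coordinates, a
product of two product measures. -/
theorem infinitePi_prod_map_unzip {ι M N : Type*} [MeasurableSpace M] [MeasurableSpace N]
    (μ : ι → Measure M) (ν : ι → Measure N) [∀ i, IsProbabilityMeasure (μ i)]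
    [∀ i, IsProbabilityMeasure (ν i)] :
    (infinitePi fun i => (μ i).prod (ν i)).map (fun z => (fun i => (z i).1, fun i => (z i).2)) =
      (infinitePi μ).prod (infinitePi ν) := by
  classical
  refine (Measure.prod_eq_generateFrom (C := squareCylinders fun _ => {s | MeasurableSet s})
    (D := squareCylinders fun _ => {s | MeasurableSet s})
    (generateFrom_squareCylinders (α := fun _ : ι => M))
    (generateFrom_squareCylinders (α := fun _ : ι => N))
    (isPiSystem_squareCylinders (fun _ => MeasurableSpace.isPiSystem_measurableSet)
      (fun _ => MeasurableSet.univ))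
    (isPiSystem_squareCylinders (fun _ => MeasurableSpace.isPiSystem_measurableSet)
      (fun _ => MeasurableSet.univ))
    ⟨fun _ => Set.univ, fun _ => ⟨∅, fun _ => Set.univ, by simp, by simp⟩,
      fun _ => by simp, Set.iUnion_const _⟩
    ⟨fun _ => Set.univ, fun _ => ⟨∅, fun _ => Set.univ, by simp, by simp⟩,
      fun _ => by simp, Set.iUnion_const _⟩
    ?_).symm
  rintro _ ⟨s, t, ht, rfl⟩ _ ⟨s', t', ht', rfl⟩
  replace ht : ∀ i, MeasurableSet (t i) := fun i => ht i trivial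
  replace ht' : ∀ i, MeasurableSet (t' i) := fun i => ht' i trivial
  -- both boxes are boxes over `s ∪ s'` once the missing sides are taken to be the whole space
  let u : ι → Set M := fun i => if i ∈ s then t i else Set.univ
  let u' : ι → Set N := fun i => if i ∈ s' then t' i else Set.univ
  have hu : ∀ i, MeasurableSet (u i) := fun i => by
    by_cases hi : i ∈ s <;> simp [u, hi, ht]
  have hu' : ∀ i, MeasurableSet (u' i) := fun i => by
    by_cases hi : i ∈ s' <;> simp [u', hi, ht']
  have e : (s : Set ι).pi t = ((s ∪ s' : Finset ι) : Set ι).pi u := by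
    ext x
    simp only [Set.mem_pi, Finset.coe_union, Set.mem_union, Finset.mem_coe, u]
    grind
  have e' : (s' : Set ι).pi t' = ((s ∪ s' : Finset ι) : Set ι).pi u' := by
    ext x
    simp only [Set.mem_pi, Finset.coe_union, Set.mem_union, Finset.mem_coe, u']
    grind
  rw [e, e', infinitePi_pi _ fun i _ => hu i, infinitePi_pi _ fun i _ => hu' i,
    Measure.map_apply (by fun_prop) ((MeasurableSet.pi (Finset.countable_toSet _)
      fun i _ => hu i).prod (MeasurableSet.pi (Finset.countable_toSet _) fun i _ => hu' i)),
    ← Finset.prod_mul_distrib]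
  have : (fun z : ι → M × N => (fun i => (z i).1, fun i => (z i).2)) ⁻¹'
      (((s ∪ s' : Finset ι) : Set ι).pi u ×ˢ ((s ∪ s' : Finset ι) : Set ι).pi u') =
      ((s ∪ s' : Finset ι) : Set ι).pi fun i => u i ×ˢ u' i := by
    ext z
    simp only [Set.mem_preimage, Set.mem_prod, Set.mem_pi]
    exact ⟨fun h i hi => ⟨h.1 i hi, h.2 i hi⟩, fun h => ⟨fun i hi => (h i hi).1,
      fun i hi => (h i hi).2⟩⟩
  rw [this, infinitePi_pi _ fun i _ => (hu i).prod (hu' i)]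
  simp [Measure.prod_prod]

theorem infinitePi_prod_map_zip {ι M N : Type*} [MeasurableSpace M] [MeasurableSpace N]
    (μ : ι → Measure M) (ν : ι → Measure N) [∀ i, IsProbabilityMeasure (μ i)]
    [∀ i, IsProbabilityMeasure (ν i)] :
    ((infinitePi μ).prod (infinitePi ν)).map (fun p i => (p.1 i, p.2 i)) =
      infinitePi fun i => (μ i).prod (ν i) := by
  rw [← infinitePi_prod_map_unzip, Measure.map_map (by fun_prop) (by fun_prop)]
  exact Measure.map_id

/-- Mixing product measures over independent random factors gives the product of the mixtures. -/
theorem bind_infinitePi {ι M : Type*} [MeasurableSpace M]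
    (ρ : ProbabilityMeasure (ProbabilityMeasure M)) :
    (infinitePi fun _ : ι => (ρ : Measure (ProbabilityMeasure M))).bind
      (fun ξ => infinitePi fun i => (ξ i : Measure M)) =
      infinitePi fun _ : ι => (firstMoment ρ : Measure M) := by
  refine eq_infinitePi _ fun s t ht => ?_
  rw [Measure.bind_apply (MeasurableSet.pi (Finset.countable_toSet _) fun i _ => ht i)
    measurable_infinitePi_probabilityMeasure.aemeasurable]
  simp_rw [infinitePi_pi _ (fun i _ => ht i)]
  have hm : ∀ i, Measurable (fun ξ : ProbabilityMeasure M => (ξ : Measure M) (t i)) := fun i =>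
    (Measure.measurable_coe (ht i)).comp measurable_subtype_coe
  have hind : iIndepFun (fun (i : ι) (ξ : ι → ProbabilityMeasure M) => (ξ i : Measure M) (t i))
      (infinitePi fun _ : ι => (ρ : Measure (ProbabilityMeasure M))) :=
    iIndepFun_infinitePi (X := fun i (ξ : ProbabilityMeasure M) => (ξ : Measure M) (t i)) hm
  rw [lintegral_prod_eq_prod_lintegral_of_indepFun s _ hind
    fun i => (hm i).comp (measurable_pi_apply i)]
  refine Finset.prod_congr rfl fun i _ => ?_
  have h1 : (firstMoment ρ : Measure M) (t i) =
      ∫⁻ ξ : ProbabilityMeasure M, (ξ : Measure M) (t i) ∂(ρ : Measure (ProbabilityMeasure M)) :=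
    Measure.bind_apply (ht i) measurable_subtype_coe.aemeasurable
  rw [h1]
  exact (measurePreserving_eval_infinitePi
    (fun _ : ι => (ρ : Measure (ProbabilityMeasure M))) i).lintegral_comp (hm i)

end ProductMeasure

/-! ### Evaluation of the random maps along the tree -/

namespace RandomMap

variable {Ω S : Type*} [MeasurableSpace Ω] [MeasurableSpace S]

/-- The map `γ[ω]` as a function of sequences of the maximal length `d`, of which only the first
`κ(ω)` entries are used. -/
def full (γ : RandomMap Ω S) {d : ℕ∞} (hd : ∀ ω, γ.arity ω ≤ d) (ω : Ω) (x : ArgIndex d → S) : S :=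
  γ.map ω fun j => x ⟨j.1, lt_of_lt_of_le j.2 (hd ω)⟩

variable (γ : RandomMap Ω S) {d : ℕ∞} (hd : ∀ ω, γ.arity ω ≤ d)

theorem measurable_full : Measurable (fun p : Ω × (ArgIndex d → S) => γ.full hd p.1 p.2) := by
  intro B hB
  -- on the part of the space where the arity is `k`, the map is `γ.toFun k`
  let F : ∀ k : {k : ℕ∞ // k ≤ d}, {ω : Ω // γ.arity ω = k.1} × (ArgIndex d → S) → S :=
    fun k p => γ.toFun k.1 p.1 fun j => p.2 ⟨j.1, lt_of_lt_of_le j.2 k.2⟩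
  have hF : ∀ k, Measurable (F k) := fun k =>
    (γ.measurable_toFun k.1).comp (measurable_fst.prodMk
      (measurable_pi_lambda _ fun j => (measurable_pi_apply
        (⟨j.1, lt_of_lt_of_le j.2 k.2⟩ : ArgIndex d)).comp measurable_snd))
  have he : ∀ k : ℕ∞, MeasurableEmbedding
      (Prod.map Subtype.val id : {ω : Ω // γ.arity ω = k} × (ArgIndex d → S) → _) := fun k =>
    (MeasurableEmbedding.subtype_coe
      (γ.measurable_arity (measurableSet_singleton k))).prodMap .id
  have : (fun p : Ω × (ArgIndex d → S) => γ.full hd p.1 p.2) ⁻¹' B =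
      ⋃ k : {k : ℕ∞ // k ≤ d}, Prod.map Subtype.val id '' (F k ⁻¹' B) := by
    ext ⟨ω, x⟩
    simp only [Set.mem_preimage, Set.mem_iUnion, Set.mem_image]
    constructor
    · intro h
      exact ⟨⟨γ.arity ω, hd ω⟩, (⟨ω, rfl⟩, x), h, rfl⟩
    · rintro ⟨⟨k, hk⟩, ⟨⟨ω', hω⟩, x'⟩, h, h'⟩
      change γ.arity ω' = k at hω
      subst hω
      obtain ⟨rfl, rfl⟩ := Prod.mk.inj h'
      exact h
  rw [this]
  exact MeasurableSet.iUnion fun k => (he k.1).measurableSet_image.2 (hF k hB)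

theorem measurable_full_apply (ω : Ω) : Measurable (γ.full hd ω) :=
  (γ.measurable_full hd).comp measurable_prodMk_left

/-- `γ̌[ω]` sends a sequence of measures of the maximal length to the image of their product. -/
theorem higher_full (ω : Ω) (ξ : ArgIndex d → ProbabilityMeasure S) :
    (γ.higher.full hd ω ξ : Measure S) =
      (Measure.infinitePi fun j => (ξ j : Measure S)).map (γ.full hd ω) := by
  let f : ArgIndex (γ.arity ω) → ArgIndex d := fun j => ⟨j.1, lt_of_lt_of_le j.2 (hd ω)⟩
  have hf : Function.Injective f := fun i j h => Subtype.ext (congrArg (fun l => l.1) h)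
  have h := Measure.map_infinitePi_infinitePi_of_inj (P := fun j => (ξ j : Measure S)) hf
  change (Measure.infinitePi fun j => (ξ (f j) : Measure S)).map (γ.map ω) = _
  rw [← h, Measure.map_map (γ.measurable_map ω) (by fun_prop)]
  rfl

/-- `T(μ)` is the law of `γ[ω](X₁, X₂, …)` with `ω`, `X₁`, `X₂`, … independent. -/
theorem rdeMap_eq_map_full (r : ProbabilityMeasure Ω) (μ : ProbabilityMeasure S) :
    (γ.rdeMap r μ : Measure S) =
      ((r : Measure Ω).prod (Measure.infinitePi fun _ : ArgIndex d => (μ : Measure S))).map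
        (fun p => γ.full hd p.1 p.2) := by
  have hlaw : ∀ ω, (γ.lawAt μ ω : Measure S) =
      (Measure.infinitePi fun _ : ArgIndex d => (μ : Measure S)).map (γ.full hd ω) := fun ω =>
    γ.higher_full hd ω fun _ => μ
  ext B hB
  rw [Measure.map_apply (γ.measurable_full hd) hB,
    Measure.prod_apply (γ.measurable_full hd hB)]
  refine (Measure.bind_apply hB
    (measurable_subtype_coe.comp (γ.measurable_lawAt μ)).aemeasurable).trans ?_
  refine lintegral_congr fun ω => ?_
  change (γ.lawAt μ ω : Measure S) B = _
  rw [hlaw, Measure.map_apply (γ.measurable_full_apply hd ω) hB]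
  rfl

/-- The value at the root of the tree that is cut off at level `t`: the states `(z i).2` with
`|i| = t` are propagated to the root through the maps `γ[(z i).1]` with `|i| < t`. -/
def treeEval : ℕ → (TreeWord d → Ω × S) → S
  | 0, z => (z []).2
  | t + 1, z => γ.full hd (z []).1 fun j => treeEval t fun i => z (j :: i)

theorem measurable_treeEval (t : ℕ) : Measurable (γ.treeEval hd t) := by
  induction t with
  | zero => exact measurable_snd.comp (measurable_pi_apply _)
  | succ t ih =>
    refine (γ.measurable_full hd).comp (Measurable.prodMk (by fun_prop) ?_)
    exact measurable_pi_lambda _ fun j => ih.comp (by fun_prop)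

/-- The value at the root depends on the noise above level `t` and the states at level `t` only. -/
theorem treeEval_congr {t : ℕ} {z z' : TreeWord d → Ω × S}
    (h1 : ∀ i : TreeWord d, i.length < t → (z i).1 = (z' i).1)
    (h2 : ∀ i : TreeWord d, i.length = t → (z i).2 = (z' i).2) :
    γ.treeEval hd t z = γ.treeEval hd t z' := by
  induction t generalizing z z' with
  | zero => exact h2 [] rfl
  | succ t ih =>
    simp only [treeEval]
    rw [h1 [] (by simp)]
    congr 1
    funext j
    exact ih (fun i hi => h1 _ (by simpa using hi)) fun i hi => h2 _ (by simpa using hi)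

/-- For independent noise and independent states of law `ρ`, the value at the root has law
`Tᵗ(ρ)`. -/
theorem map_treeEval (r : ProbabilityMeasure Ω) (ρ : ProbabilityMeasure S) (t : ℕ) :
    (Measure.infinitePi fun _ : TreeWord d => (r : Measure Ω).prod (ρ : Measure S)).map
      (γ.treeEval hd t) = ((γ.rdeMap r)^[t] ρ : ProbabilityMeasure S) := by
  induction t with
  | zero =>
    have : γ.treeEval hd 0 = Prod.snd ∘ fun z : TreeWord d → Ω × S => z [] := rfl
    rw [this, ← Measure.map_map measurable_snd (measurable_pi_apply _),
      Measure.infinitePi_map_eval]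
    simp
  | succ t ih =>
    have hm : Measurable (fun (z : ArgIndex d → TreeWord d → Ω × S) (j : ArgIndex d) =>
        γ.treeEval hd t (z j)) :=
      measurable_pi_lambda _ fun j => (γ.measurable_treeEval hd t).comp (measurable_pi_apply j)
    have : γ.treeEval hd (t + 1) = (fun p : Ω × (ArgIndex d → S) => γ.full hd p.1 p.2) ∘
        Prod.map Prod.fst (fun z j => γ.treeEval hd t (z j)) ∘
        fun z => (z [], fun (j : ArgIndex d) (i : TreeWord d) => z (j :: i)) := rfl
    rw [this, ← Measure.map_map (γ.measurable_full hd)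
        ((measurable_fst.prodMap hm).comp (by fun_prop)),
      ← Measure.map_map (measurable_fst.prodMap hm) (by fun_prop), infinitePi_map_root_subtrees,
      ← Measure.map_prod_map _ _ measurable_fst hm,
      Measure.infinitePi_map_pi _ fun _ => γ.measurable_treeEval hd t, ih,
      Function.iterate_succ_apply', rdeMap_eq_map_full γ hd]
    simp

/-- The higher-level evaluation computes the law of the value at the root when the noise is fixed
and the states are independent with the given laws. -/
theorem higher_treeEval (t : ℕ) (w : TreeWord d → Ω) (ξ : TreeWord d → ProbabilityMeasure S) :
    (γ.higher.treeEval hd t (fun i => (w i, ξ i)) : Measure S) =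
      (Measure.infinitePi fun i => (ξ i : Measure S)).map
        (fun x => γ.treeEval hd t fun i => (w i, x i)) := by
  have hw : ∀ w : TreeWord d → Ω, Measurable fun (x : TreeWord d → S) (i : TreeWord d) =>
      (w i, x i) := fun w =>
    measurable_pi_lambda _ fun i => measurable_const.prodMk (measurable_pi_apply i)
  induction t generalizing w ξ with
  | zero => exact (Measure.infinitePi_map_eval (fun i => (ξ i : Measure S)) []).symm
  | succ t ih =>
    have hg : ∀ j : ArgIndex d, Measurable fun x : TreeWord d → S =>
        γ.treeEval hd t fun i => (w (j :: i), x i) := fun j =>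
      (γ.measurable_treeEval hd t).comp (hw _)
    have hm : Measurable (fun (z : ArgIndex d → TreeWord d → S) (j : ArgIndex d) =>
        γ.treeEval hd t fun i => (w (j :: i), z j i)) :=
      measurable_pi_lambda _ fun j => (hg j).comp (measurable_pi_apply j)
    have : (fun x : TreeWord d → S => γ.treeEval hd (t + 1) fun i => (w i, x i)) =
        γ.full hd (w []) ∘ (fun (z : ArgIndex d → TreeWord d → S) (j : ArgIndex d) =>
          γ.treeEval hd t fun i => (w (j :: i), z j i)) ∘ Prod.snd ∘
        fun z => (z [], fun (j : ArgIndex d) (i : TreeWord d) => z (j :: i)) := rfl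
    rw [this, ← Measure.map_map (γ.measurable_full_apply hd _)
        (hm.comp (measurable_snd.comp (by fun_prop))),
      ← Measure.map_map hm (measurable_snd.comp (by fun_prop)),
      ← Measure.map_map measurable_snd (by fun_prop), infinitePi_map_root_subtrees,
      Measure.map_snd_prod, measure_univ, one_smul, Measure.infinitePi_map_pi _ hg]
    change (γ.higher.full hd (w []) (fun j => γ.higher.treeEval hd t
      fun i => (w (j :: i), ξ (j :: i))) : Measure S) = _
    rw [higher_full]
    simp_rw [ih]

end RandomMap

/-! ### Weak convergence of laws of random probability measures -/

section WeakConvergence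

open scoped BoundedContinuousFunction

variable {S : Type*} [TopologicalSpace S] [MeasurableSpace S]

/-- The weak topology is the topology of convergence of the integrals of bounded continuous
functions. -/
theorem isInducing_integral [OpensMeasurableSpace S] :
    IsInducing (fun (ξ : ProbabilityMeasure S) (f : S →ᵇ ℝ) => ∫ x, f x ∂(ξ : Measure S)) := by
  refine isInducing_iff_nhds.2 fun ξ => le_antisymm ?_ ?_
  · refine Tendsto.le_comap (tendsto_pi_nhds.2 fun f => ?_)
    exact ProbabilityMeasure.tendsto_iff_forall_integral_tendsto.1 tendsto_id f
  · have h : Tendsto id (comap (fun (ξ : ProbabilityMeasure S) (f : S →ᵇ ℝ) =>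
        ∫ x, f x ∂(ξ : Measure S)) (𝓝 fun f => ∫ x, f x ∂(ξ : Measure S))) (𝓝 ξ) :=
      ProbabilityMeasure.tendsto_iff_forall_integral_tendsto.2
        (tendsto_pi_nhds.1 tendsto_comap)
    exact h

theorem continuous_integral_probabilityMeasure [OpensMeasurableSpace S] (f : S →ᵇ ℝ) :
    Continuous fun ξ : ProbabilityMeasure S => ∫ x, f x ∂(ξ : Measure S) :=
  (continuous_pi_iff.1 isInducing_integral.continuous) f

/-- The space of probability measures on a separable metrizable space is second countable: the sets
`{ξ | q < ξ G}` with rational `q` and `G` a finite union of basic open sets form a subbasis. -/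
theorem secondCountableTopology_probabilityMeasure [SecondCountableTopology S]
    [TopologicalSpace.PseudoMetrizableSpace S] [BorelSpace S] :
    SecondCountableTopology (ProbabilityMeasure S) := by
  let : PseudoMetricSpace S := TopologicalSpace.pseudoMetrizableSpacePseudoMetric S
  have hB := TopologicalSpace.isBasis_countableBasis S
  let sub : Finset (Set S) × ℚ → Set (ProbabilityMeasure S) :=
    fun i => {ν | Real.toNNReal i.2 < ν (⋃ t ∈ i.1, t)}
  let J : Set (Finset (Set S) × ℚ) :=
    {T : Finset (Set S) | (T : Set (Set S)) ⊆ TopologicalSpace.countableBasis S} ×ˢ Set.univ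
  have hJ : J.Countable := by
    refine Set.Countable.prod ?_ Set.countable_univ
    have h1 := Set.countable_ofPred_finite_subset
      (TopologicalSpace.countable_countableBasis S)
    have h2 := h1.preimage (f := fun T : Finset (Set S) => (T : Set (Set S)))
      Finset.coe_injective
    exact h2.mono fun T hT => And.intro T.finite_toSet hT
  refine ⟨⟨sub '' J, hJ.image sub, le_antisymm ?_ ?_⟩⟩
  · refine le_generateFrom ?_
    rintro _ ⟨⟨T, q⟩, hT, rfl⟩
    rw [isOpen_iff_mem_nhds]
    intro ξ hξ
    have hG : IsOpen (⋃ t ∈ T, t) :=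
      isOpen_biUnion fun t ht => hB.isOpen (hT.1 ht)
    have h1 : (ξ : Measure S) (⋃ t ∈ T, t) ≤
        (𝓝 ξ).liminf (fun ν : ProbabilityMeasure S => (ν : Measure S) (⋃ t ∈ T, t)) :=
      ProbabilityMeasure.le_liminf_measure_open_of_tendsto tendsto_id hG
    have hlt : ∀ ν : ProbabilityMeasure S, Real.toNNReal q < ν (⋃ t ∈ T, t) ↔
        (Real.toNNReal q : ENNReal) < (ν : Measure S) (⋃ t ∈ T, t) := fun ν => by
      rw [← ProbabilityMeasure.ennreal_coeFn_eq_coeFn_toMeasure, ENNReal.coe_lt_coe]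
    have h2 := (hlt ξ).1 hξ
    filter_upwards [eventually_lt_of_lt_liminf (lt_of_lt_of_le h2 h1)] with ν hν
    exact (hlt ν).2 hν
  · intro U hU
    refine isOpen_generateFrom_of_tendsto (hJ.image sub) ?_ hU
    intro μ L hL hmem
    rcases L.eq_or_neBot with rfl | hne
    · simp
    apply tendsto_of_forall_isOpen_le_liminf
    intro G hG
    refine (le_liminf_iff (isCoboundedUnder_ge_of_le (x := 1) _ (by simp))
      (by isBoundedDefault)).2 (fun r hr ↦ ?_)
    obtain ⟨T, hTB, hrT, hTG⟩ := μ.exists_lt_measure_biUnion_of_isOpen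
      (S := TopologicalSpace.countableBasis S)
      (fun u hu x hx => by
        obtain ⟨v, hv, hxv, hvu⟩ := hB.exists_subset_of_mem_open hx hu
        exact ⟨v, hv, (hB.isOpen hv).mem_nhds hxv, hvu⟩) hG hr
    obtain ⟨q, -, hq1, hq2⟩ := (NNReal.lt_iff_exists_rat_btwn _ _).1 hrT
    filter_upwards [hmem _ ⟨(T, q), ⟨fun t ht => hTB t ht, trivial⟩, rfl⟩ hq2] with ν hν
    exact hq1.trans (lt_of_lt_of_le hν (ProbabilityMeasure.apply_mono _ hTG))

/-- Every open set of probability measures is a countable union of sets `{h k > 0}`, where each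
`h k` is nonnegative, continuous, and Lipschitz in finitely many integrals of bounded continuous
functions. -/
theorem exists_seq_lipschitz_of_isOpen [SecondCountableTopology S]
    [TopologicalSpace.PseudoMetrizableSpace S] [BorelSpace S] {G : Set (ProbabilityMeasure S)}
    (hG : IsOpen G) :
    ∃ (h : ℕ → ProbabilityMeasure S → ℝ) (I : ℕ → Finset (S →ᵇ ℝ)) (C : ℕ → ℝ),
      (∀ k ξ, 0 ≤ h k ξ) ∧ (∀ k, Continuous (h k)) ∧ (∀ k, ∀ ξ ∉ G, h k ξ = 0) ∧
      (∀ ξ ∈ G, ∃ k, 0 < h k ξ) ∧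
      ∀ k ξ η, |h k ξ - h k η| ≤
        C k * ∑ f ∈ I k, |∫ x, f x ∂(ξ : Measure S) - ∫ x, f x ∂(η : Measure S)| := by
  have := secondCountableTopology_probabilityMeasure (S := S)
  rcases G.eq_empty_or_nonempty with rfl | ⟨ξ₁, hξ₁⟩
  · exact ⟨fun _ _ => 0, fun _ => ∅, fun _ => 0, by simp, fun _ => continuous_const, by simp,
      by simp, by simp⟩
  have key : ∀ ξ₀ : G, ∃ (h : ProbabilityMeasure S → ℝ) (I : Finset (S →ᵇ ℝ)) (C : ℝ),
      (∀ ξ, 0 ≤ h ξ) ∧ Continuous h ∧ (∀ ξ ∉ G, h ξ = 0) ∧ 0 < h ξ₀ ∧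
      ∀ ξ η, |h ξ - h η| ≤
        C * ∑ f ∈ I, |∫ x, f x ∂(ξ : Measure S) - ∫ x, f x ∂(η : Measure S)| := by
    rintro ⟨ξ₀, hξ₀⟩
    have h1 := hG.mem_nhds hξ₀
    rw [isInducing_integral.nhds_eq_comap, mem_comap] at h1
    obtain ⟨V, hV, hVG⟩ := h1
    rw [nhds_pi, Filter.mem_pi'] at hV
    obtain ⟨I, t, ht, htV⟩ := hV
    choose ε hε hεt using fun f => Metric.mem_nhds_iff.1 (ht f)
    obtain ⟨δ, hδ, hδε⟩ : ∃ δ > 0, ∀ f ∈ I, δ ≤ ε f := by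
      rcases I.eq_empty_or_nonempty with rfl | hI
      · exact ⟨1, one_pos, by simp⟩
      · obtain ⟨f₀, hf₀, hmin⟩ := I.exists_min_image ε hI
        exact ⟨ε f₀, hε f₀, hmin⟩
    -- a bump at `ξ₀` of width `δ` in the integrals of the functions in `I`
    let D : ProbabilityMeasure S → ℝ := fun ξ =>
      ∑ f ∈ I, |∫ x, f x ∂(ξ : Measure S) - ∫ x, f x ∂(ξ₀ : Measure S)|
    have hD : Continuous D := continuous_finsetSum _ fun f _ =>
      ((continuous_integral_probabilityMeasure f).sub continuous_const).abs
    refine ⟨fun ξ => max 0 (δ - D ξ), I, 1, fun ξ => le_max_left _ _,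
      continuous_const.max (continuous_const.sub hD), fun ξ hξ => ?_, ?_, fun ξ η => ?_⟩
    · refine max_eq_left (sub_nonpos.2 ?_)
      by_contra! hlt
      refine hξ (hVG (htV fun f hf => hεt f ?_))
      have h2 : |∫ x, f x ∂(ξ : Measure S) - ∫ x, f x ∂(ξ₀ : Measure S)| ≤ D ξ :=
        Finset.single_le_sum (f := fun f : S →ᵇ ℝ =>
          |∫ x, f x ∂(ξ : Measure S) - ∫ x, f x ∂(ξ₀ : Measure S)|)
          (fun f _ => abs_nonneg _) hf
      rw [Metric.mem_ball, Real.dist_eq]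
      exact (h2.trans_lt hlt).trans_le (hδε f hf)
    · simp [D, hδ]
    · rw [one_mul]
      have h3 : |D ξ - D η| ≤
          ∑ f ∈ I, |∫ x, f x ∂(ξ : Measure S) - ∫ x, f x ∂(η : Measure S)| := by
        simp only [D]
        rw [← Finset.sum_sub_distrib]
        refine (Finset.abs_sum_le_sum_abs _ _).trans (Finset.sum_le_sum fun f _ => ?_)
        refine (abs_abs_sub_abs_le _ _).trans_eq ?_
        congr 1
        ring
      refine le_trans ?_ h3
      refine (abs_max_sub_max_le_max _ _ _ _).trans (max_le (by simp) ?_)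
      rw [sub_sub_sub_cancel_left, abs_sub_comm]
  choose h I C h0 hc hz hp hL using key
  obtain ⟨s, hs, hsG⟩ := TopologicalSpace.isOpen_iUnion_countable
    (fun ξ₀ : G => {ξ | 0 < h ξ₀ ξ}) fun ξ₀ => isOpen_lt continuous_const (hc ξ₀)
  have hne : s.Nonempty := by
    have : ξ₁ ∈ ⋃ ξ₀ : G, {ξ | 0 < h ξ₀ ξ} := Set.mem_iUnion.2 ⟨⟨ξ₁, hξ₁⟩, hp _⟩
    rw [← hsG] at this
    obtain ⟨i, hi, -⟩ := Set.mem_iUnion₂.1 this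
    exact ⟨i, hi⟩
  obtain ⟨u, rfl⟩ := hs.exists_eq_range hne
  refine ⟨fun k => h (u k), fun k => I (u k), fun k => C (u k), fun k => h0 _, fun k => hc _,
    fun k => hz _, fun ξ hξ => ?_, fun k => hL _⟩
  have : ξ ∈ ⋃ ξ₀ : G, {ξ | 0 < h ξ₀ ξ} := Set.mem_iUnion.2 ⟨⟨ξ, hξ⟩, hp _⟩
  rw [← hsG] at this
  obtain ⟨_, ⟨k, rfl⟩, hk⟩ := Set.mem_iUnion₂.1 this
  exact ⟨k, hk⟩

/-- If random probability measures `ξ_t` and `η_t` are coupled in such a way that `ξ_t f - η_t f`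
tends to zero in `L¹` for all bounded continuous `f`, and `η_t` has a law `ν` that does not depend
on `t`, then the laws of `ξ_t` tend weakly to `ν`. -/
theorem tendsto_law_of_coupling [SecondCountableTopology S]
    [TopologicalSpace.PseudoMetrizableSpace S] [BorelSpace S]
    {ν : ProbabilityMeasure (ProbabilityMeasure S)}
    {νs : ℕ → ProbabilityMeasure (ProbabilityMeasure S)}
    (π : ℕ → Measure (ProbabilityMeasure S × ProbabilityMeasure S))
    (h1 : ∀ t, (π t).map Prod.fst = νs t) (h2 : ∀ t, (π t).map Prod.snd = ν)
    (hπ : ∀ f : S →ᵇ ℝ, Tendsto (fun t => ∫ p, |∫ x, f x ∂(p.1 : Measure S) -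
      ∫ x, f x ∂(p.2 : Measure S)| ∂π t) atTop (𝓝 0)) :
    Tendsto νs atTop (𝓝 ν) := by
  have hprob : ∀ t, IsProbabilityMeasure (π t) := fun t => by
    constructor
    have := congrArg (fun m => m Set.univ) (h1 t)
    simpa [Measure.map_apply measurable_fst] using this
  have hsc := secondCountableTopology_probabilityMeasure (S := S)
  refine tendsto_of_forall_isOpen_le_liminf' fun G hG => ?_
  obtain ⟨h, I, C, h0, hc, hz, hp, hL⟩ := exists_seq_lipschitz_of_isOpen hG
  -- `H n` increases to the indicator function of `G`
  let H : ℕ → ProbabilityMeasure S → ℝ := fun n ξ => min 1 (n * ∑ k ∈ Finset.range n, h k ξ)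
  have hHc : ∀ n, Continuous (H n) := fun n => continuous_const.min
    (continuous_const.mul (continuous_finsetSum _ fun k _ => hc k))
  have hH0 : ∀ n ξ, 0 ≤ H n ξ := fun n ξ => le_min zero_le_one
    (mul_nonneg n.cast_nonneg (Finset.sum_nonneg fun k _ => h0 k ξ))
  have hH1 : ∀ n ξ, H n ξ ≤ 1 := fun n ξ => min_le_left _ _
  have hHb : ∀ n ξ, ‖H n ξ‖ ≤ 1 := fun n ξ => by
    rw [Real.norm_of_nonneg (hH0 n ξ)]; exact hH1 n ξ
  have hHG : ∀ n, ∀ ξ ∉ G, H n ξ = 0 := fun n ξ hξ => by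
    simp [H, fun k => hz k ξ hξ]
  have hHint : ∀ (m : Measure (ProbabilityMeasure S)) [IsProbabilityMeasure m] n,
      Integrable (H n) m := fun m _ n =>
    Integrable.of_bound (hHc n).aestronglyMeasurable 1 (Eventually.of_forall (hHb n))
  have hHlim : ∀ ξ, Tendsto (fun n => H n ξ) atTop (𝓝 (G.indicator 1 ξ)) := by
    intro ξ
    by_cases hξ : ξ ∈ G
    · rw [Set.indicator_of_mem hξ]
      obtain ⟨k, hk⟩ := hp ξ hξ
      obtain ⟨N, hN⟩ := exists_nat_gt (1 / h k ξ)
      refine tendsto_const_nhds.congr' ?_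
      filter_upwards [eventually_ge_atTop (max N (k + 1))] with n hn
      symm
      refine min_eq_left ?_
      have h3 : h k ξ ≤ ∑ k ∈ Finset.range n, h k ξ :=
        Finset.single_le_sum (f := fun k => h k ξ) (fun k _ => h0 k ξ)
          (Finset.mem_range.2 ((le_max_right _ _).trans hn))
      have h4 : (N : ℝ) ≤ n := Nat.cast_le.2 ((le_max_left _ _).trans hn)
      calc (1 : ℝ) = 1 / h k ξ * h k ξ := by field_simp
        _ ≤ n * ∑ k ∈ Finset.range n, h k ξ := by
          gcongr
          exact hN.le.trans h4
    · rw [Set.indicator_of_notMem hξ]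
      simp [hHG _ ξ hξ]
  -- the integrals of the functions `H n` converge
  have hHt : ∀ n, Tendsto (fun t => ∫ ξ, H n ξ ∂(νs t : Measure (ProbabilityMeasure S))) atTop
      (𝓝 (∫ ξ, H n ξ ∂(ν : Measure (ProbabilityMeasure S)))) := by
    intro n
    let D : ProbabilityMeasure S × ProbabilityMeasure S → ℝ := fun p => n * ∑ k ∈ Finset.range n,
      C k * ∑ f ∈ I k, |∫ x, f x ∂(p.1 : Measure S) - ∫ x, f x ∂(p.2 : Measure S)|
    have hint : ∀ (f : S →ᵇ ℝ) t, Integrable (fun p : ProbabilityMeasure S × ProbabilityMeasure S =>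
        |∫ x, f x ∂(p.1 : Measure S) - ∫ x, f x ∂(p.2 : Measure S)|) (π t) := fun f t => by
      refine Integrable.of_bound (Continuous.aestronglyMeasurable ?_) (2 * ‖f‖)
        (Eventually.of_forall fun p => ?_)
      · exact (((continuous_integral_probabilityMeasure f).comp continuous_fst).sub
          ((continuous_integral_probabilityMeasure f).comp continuous_snd)).abs
      · rw [Real.norm_eq_abs, abs_abs, two_mul]
        exact (abs_sub _ _).trans (add_le_add (f.norm_integral_le_norm _)
          (f.norm_integral_le_norm _))
    have hDint : ∀ t, Integrable D (π t) := fun t =>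
      (integrable_finsetSum _ fun k _ => (integrable_finsetSum _ fun f _ =>
        hint f t).const_mul _).const_mul _
    have hD : Tendsto (fun t => ∫ p, D p ∂π t) atTop (𝓝 0) := by
      have : ∀ t, ∫ p, D p ∂π t = n * ∑ k ∈ Finset.range n, C k * ∑ f ∈ I k,
          ∫ p, |∫ x, f x ∂(p.1 : Measure S) - ∫ x, f x ∂(p.2 : Measure S)| ∂π t := fun t => by
        simp only [D]
        rw [integral_const_mul, integral_finsetSum _ fun k _ =>
          (integrable_finsetSum _ fun f _ => hint f t).const_mul _]
        congr 1
        refine Finset.sum_congr rfl fun k _ => ?_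
        rw [integral_const_mul, integral_finsetSum _ fun f _ => hint f t]
      simp_rw [this]
      have h5 : Tendsto (fun t => n * ∑ k ∈ Finset.range n, C k * ∑ f ∈ I k,
          ∫ p, |∫ x, f x ∂(p.1 : Measure S) - ∫ x, f x ∂(p.2 : Measure S)| ∂π t) atTop
          (𝓝 (n * ∑ k ∈ Finset.range n, C k * ∑ f ∈ I k, 0)) :=
        (tendsto_finsetSum _ fun k _ => (tendsto_finsetSum _ fun f _ =>
          hπ f).const_mul _).const_mul _
      simpa using h5
    have hdiff : ∀ p : ProbabilityMeasure S × ProbabilityMeasure S, |H n p.1 - H n p.2| ≤ D p := by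
      intro p
      have h6 : |n * ∑ k ∈ Finset.range n, h k p.1 - n * ∑ k ∈ Finset.range n, h k p.2| ≤ D p := by
        rw [← mul_sub, abs_mul, Nat.abs_cast, ← Finset.sum_sub_distrib]
        exact mul_le_mul_of_nonneg_left ((Finset.abs_sum_le_sum_abs _ _).trans
          (Finset.sum_le_sum fun k _ => hL k p.1 p.2)) n.cast_nonneg
      refine (abs_min_sub_min_le_max _ _ _ _).trans (max_le ?_ h6)
      rw [sub_self, abs_zero]
      exact (abs_nonneg _).trans h6
    rw [tendsto_iff_dist_tendsto_zero]
    refine squeeze_zero (fun t => dist_nonneg) (fun t => ?_) hD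
    rw [Real.dist_eq, ← h1 t, ← h2 t,
      integral_map measurable_fst.aemeasurable (hHc n).aestronglyMeasurable,
      integral_map measurable_snd.aemeasurable (hHc n).aestronglyMeasurable, ← integral_sub]
    · refine abs_integral_le_integral_abs.trans (integral_mono_of_nonneg
        (Eventually.of_forall fun p => abs_nonneg _) (hDint t) (Eventually.of_forall hdiff))
    · exact Integrable.of_bound ((hHc n).comp continuous_fst).aestronglyMeasurable 1
        (Eventually.of_forall fun p => hHb n p.1)
    · exact Integrable.of_bound ((hHc n).comp continuous_snd).aestronglyMeasurable 1
        (Eventually.of_forall fun p => hHb n p.2)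
  have hle : ∀ (m : Measure (ProbabilityMeasure S)) [IsProbabilityMeasure m] n,
      ENNReal.ofReal (∫ ξ, H n ξ ∂m) ≤ m G := by
    intro m _ n
    rw [← ENNReal.ofReal_toReal (measure_ne_top m G)]
    refine ENNReal.ofReal_le_ofReal ?_
    change _ ≤ m.real G
    rw [← integral_indicator_one hG.measurableSet]
    refine integral_mono (hHint m n) ((integrable_const (1 : ℝ)).indicator hG.measurableSet)
      fun ξ => ?_
    by_cases hξ : ξ ∈ G
    · simp [hξ, hH1 n ξ]
    · simp [hξ, hHG n ξ hξ]
  have hνG : Tendsto (fun n => ENNReal.ofReal (∫ ξ, H n ξ ∂(ν : Measure (ProbabilityMeasure S))))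
      atTop (𝓝 ((ν : Measure (ProbabilityMeasure S)) G)) := by
    rw [← ENNReal.ofReal_toReal (measure_ne_top (ν : Measure (ProbabilityMeasure S)) G)]
    refine ENNReal.tendsto_ofReal ?_
    change Tendsto _ _ (𝓝 ((ν : Measure (ProbabilityMeasure S)).real G))
    rw [← integral_indicator_one hG.measurableSet]
    exact tendsto_integral_of_dominated_convergence (fun _ => 1)
      (fun n => (hHc n).aestronglyMeasurable) (integrable_const _)
      (fun n => Eventually.of_forall (hHb n)) (Eventually.of_forall hHlim)
  refine le_of_tendsto hνG (Eventually.of_forall fun n => ?_)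
  rw [← (ENNReal.tendsto_ofReal (hHt n)).liminf_eq]
  exact liminf_le_liminf (Eventually.of_forall fun t => hle _ n)

theorem sq_integral_le_integral_sq {α : Type*} [MeasurableSpace α] {m : Measure α}
    [IsProbabilityMeasure m] {g : α → ℝ} (hg : MemLp g 2 m) :
    (∫ x, g x ∂m) ^ 2 ≤ ∫ x, g x ^ 2 ∂m := by
  have h1 := variance_eq_sub hg
  have h2 := variance_nonneg g m
  simp only [Pi.pow_apply] at h1
  linarith

/-- If the laws `ν_t'` tend to `μ̄`, and the laws `ν_t` have first moment measure `μ` and second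
moments that dominate those of `ν_t'`, then the laws `ν_t` tend to `μ̄` as well: for `ξ` with law
`ν_t` and `X` with conditional law `ξ`, the mean square of `f X - ξ f` is `∫ f² dμ` minus the second
moment of `ξ f`. -/
theorem tendsto_diracLaw_of_sq_le [SecondCountableTopology S]
    [TopologicalSpace.PseudoMetrizableSpace S] [BorelSpace S]
    {μ : ProbabilityMeasure S} {νs νs' : ℕ → ProbabilityMeasure (ProbabilityMeasure S)}
    (hν' : Tendsto νs' atTop (𝓝 (diracLaw μ))) (hm : ∀ t, firstMoment (νs t) = μ)
    (hle : ∀ (f : S →ᵇ ℝ) t,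
      ∫ ξ : ProbabilityMeasure S, (∫ x, f x ∂(ξ : Measure S)) ^ 2
        ∂(νs' t : Measure (ProbabilityMeasure S)) ≤
      ∫ ξ : ProbabilityMeasure S, (∫ x, f x ∂(ξ : Measure S)) ^ 2
        ∂(νs t : Measure (ProbabilityMeasure S))) :
    Tendsto νs atTop (𝓝 (diracLaw μ)) := by
  let K : Kernel (ProbabilityMeasure S) S := ⟨fun ξ => ξ, measurable_subtype_coe⟩
  have hK : IsMarkovKernel K := ⟨fun ξ => ξ.2⟩
  have hdirac : Measurable (diracProba : S → ProbabilityMeasure S) :=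
    Measurable.subtype_mk Measure.measurable_dirac
  have hδ : Measurable (fun p : ProbabilityMeasure S × S => (p.1, diracProba p.2)) :=
    measurable_fst.prodMk (hdirac.comp measurable_snd)
  have hsnd : ∀ t, ((νs t : Measure (ProbabilityMeasure S)) ⊗ₘ K).snd = μ := fun t => by
    rw [Measure.snd_compProd, ← hm t]
    rfl
  have hfd : ∀ (f : S →ᵇ ℝ) (x : S), ∫ y, f y ∂(diracProba x : Measure S) = f x := fun f x =>
    integral_dirac' _ _ f.continuous.stronglyMeasurable
  have hfm : ∀ f : S →ᵇ ℝ, Measurable fun ξ : ProbabilityMeasure S => ∫ x, f x ∂(ξ : Measure S) :=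
    fun f => (continuous_integral_probabilityMeasure f).measurable
  have hfb : ∀ (f : S →ᵇ ℝ) (ξ : ProbabilityMeasure S), |∫ x, f x ∂(ξ : Measure S)| ≤ ‖f‖ :=
    fun f ξ => f.norm_integral_le_norm _
  -- everything is bounded, hence integrable
  have hmeasp : ∀ f : S →ᵇ ℝ, Measurable fun p : ProbabilityMeasure S × S =>
      ∫ x, f x ∂(p.1 : Measure S) := fun f => (hfm f).comp measurable_fst
  have hmeasq : ∀ f : S →ᵇ ℝ, Measurable fun p : ProbabilityMeasure S × S => f p.2 :=
    fun f => f.continuous.measurable.comp measurable_snd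
  refine tendsto_law_of_coupling
    (fun t => ((νs t : Measure (ProbabilityMeasure S)) ⊗ₘ K).map fun p => (p.1, diracProba p.2))
    (fun t => ?_) (fun t => ?_) fun f => ?_
  · rw [Measure.map_map measurable_fst hδ]
    exact Measure.fst_compProd _ _
  · rw [Measure.map_map measurable_snd hδ]
    change Measure.map (diracProba ∘ Prod.snd) _ = (μ : Measure S).map diracProba
    rw [← Measure.map_map hdirac measurable_snd, ← hsnd t]
    rfl
  · have hmean : ∀ t, ∫ p : ProbabilityMeasure S × S, (∫ x, f x ∂(p.1 : Measure S) - f p.2) ^ 2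
        ∂((νs t : Measure (ProbabilityMeasure S)) ⊗ₘ K) = ∫ x, f x ^ 2 ∂(μ : Measure S) -
        ∫ ξ : ProbabilityMeasure S, (∫ x, f x ∂(ξ : Measure S)) ^ 2
          ∂(νs t : Measure (ProbabilityMeasure S)) := by
      intro t
      have hi1 : Integrable (fun p : ProbabilityMeasure S × S => (∫ x, f x ∂(p.1 : Measure S)) ^ 2)
          ((νs t : Measure (ProbabilityMeasure S)) ⊗ₘ K) := by
        refine Integrable.of_bound ((hmeasp f).pow_const 2).aestronglyMeasurable (‖f‖ ^ 2)
          (Eventually.of_forall fun p => ?_)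
        rw [norm_pow]
        exact pow_le_pow_left₀ (norm_nonneg _) (hfb f p.1) 2
      have hi2 : Integrable (fun p : ProbabilityMeasure S × S =>
          (∫ x, f x ∂(p.1 : Measure S)) * f p.2)
          ((νs t : Measure (ProbabilityMeasure S)) ⊗ₘ K) := by
        refine Integrable.of_bound ((hmeasp f).mul (hmeasq f)).aestronglyMeasurable (‖f‖ * ‖f‖)
          (Eventually.of_forall fun p => ?_)
        rw [norm_mul]
        exact mul_le_mul (hfb f p.1) (f.norm_coe_le_norm _) (norm_nonneg _) (norm_nonneg _)
      have hi3 : Integrable (fun p : ProbabilityMeasure S × S => f p.2 ^ 2)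
          ((νs t : Measure (ProbabilityMeasure S)) ⊗ₘ K) := by
        refine Integrable.of_bound ((hmeasq f).pow_const 2).aestronglyMeasurable (‖f‖ ^ 2)
          (Eventually.of_forall fun p => ?_)
        rw [norm_pow]
        exact pow_le_pow_left₀ (norm_nonneg _) (f.norm_coe_le_norm _) 2
      have e1 : ∫ p : ProbabilityMeasure S × S, (∫ x, f x ∂(p.1 : Measure S)) ^ 2
          ∂((νs t : Measure (ProbabilityMeasure S)) ⊗ₘ K) =
          ∫ ξ : ProbabilityMeasure S, (∫ x, f x ∂(ξ : Measure S)) ^ 2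
            ∂(νs t : Measure (ProbabilityMeasure S)) := by
        rw [Measure.integral_compProd hi1]
        simp
      have e2 : ∫ p : ProbabilityMeasure S × S, (∫ x, f x ∂(p.1 : Measure S)) * f p.2
          ∂((νs t : Measure (ProbabilityMeasure S)) ⊗ₘ K) =
          ∫ ξ : ProbabilityMeasure S, (∫ x, f x ∂(ξ : Measure S)) ^ 2
            ∂(νs t : Measure (ProbabilityMeasure S)) := by
        rw [Measure.integral_compProd hi2]
        refine integral_congr_ae (Eventually.of_forall fun ξ => ?_)
        simp only [integral_const_mul, sq]
        rfl
      have e3 : ∫ p : ProbabilityMeasure S × S, f p.2 ^ 2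
          ∂((νs t : Measure (ProbabilityMeasure S)) ⊗ₘ K) = ∫ x, f x ^ 2 ∂(μ : Measure S) := by
        rw [← hsnd t, Measure.snd, integral_map measurable_snd.aemeasurable
          (f.continuous.measurable.pow_const 2).aestronglyMeasurable]
      simp_rw [sub_sq, mul_assoc]
      have hi12 : Integrable (fun p : ProbabilityMeasure S × S =>
          (∫ x, f x ∂(p.1 : Measure S)) ^ 2 - 2 * ((∫ x, f x ∂(p.1 : Measure S)) * f p.2))
          ((νs t : Measure (ProbabilityMeasure S)) ⊗ₘ K) := hi1.sub (hi2.const_mul 2)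
      rw [integral_add hi12 hi3, integral_sub hi1 (hi2.const_mul 2),
        integral_const_mul, e1, e2, e3]
      ring
    have hlim : Tendsto (fun t => ∫ ξ : ProbabilityMeasure S, (∫ x, f x ∂(ξ : Measure S)) ^ 2
        ∂(νs' t : Measure (ProbabilityMeasure S))) atTop (𝓝 (∫ x, f x ^ 2 ∂(μ : Measure S))) := by
      let F : ProbabilityMeasure S →ᵇ ℝ := BoundedContinuousFunction.ofNormedAddCommGroup
        (fun ξ => (∫ x, f x ∂(ξ : Measure S)) ^ 2)
        ((continuous_integral_probabilityMeasure f).pow 2) (‖f‖ ^ 2) fun ξ => by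
          rw [norm_pow]
          exact pow_le_pow_left₀ (norm_nonneg _) (hfb f ξ) 2
      have h3 := ProbabilityMeasure.tendsto_iff_forall_integral_tendsto.1 hν' F
      have h4 : ∫ ξ, F ξ ∂(diracLaw μ : Measure (ProbabilityMeasure S)) =
          ∫ x, f x ^ 2 ∂(μ : Measure S) := by
        refine (integral_map hdirac.aemeasurable F.continuous.aestronglyMeasurable).trans ?_
        refine integral_congr_ae (Eventually.of_forall fun x => ?_)
        change (∫ y, f y ∂(diracProba x : Measure S)) ^ 2 = _
        rw [hfd]
      rw [h4] at h3
      exact h3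
    have h0 : Tendsto (fun t => √(∫ x, f x ^ 2 ∂(μ : Measure S) -
        ∫ ξ : ProbabilityMeasure S, (∫ x, f x ∂(ξ : Measure S)) ^ 2
          ∂(νs' t : Measure (ProbabilityMeasure S)))) atTop (𝓝 0) := by
      have := (hlim.const_sub (∫ x, f x ^ 2 ∂(μ : Measure S))).sqrt
      simpa using this
    refine squeeze_zero (fun t => integral_nonneg fun p => abs_nonneg _) (fun t => ?_) h0
    refine Real.le_sqrt_of_sq_le ?_
    rw [integral_map hδ.aemeasurable]
    · simp only [hfd]
      refine (sq_integral_le_integral_sq ?_).trans ?_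
      · refine MemLp.of_bound ((hmeasp f).sub (hmeasq f)).abs.aestronglyMeasurable (2 * ‖f‖)
          (Eventually.of_forall fun p => ?_)
        rw [Real.norm_eq_abs, abs_abs, two_mul]
        exact (abs_sub _ _).trans (add_le_add (hfb f p.1) (f.norm_coe_le_norm _))
      · simp only [sq_abs]
        rw [hmean]
        linarith [hle f t]
    · exact (((hfm f).comp measurable_fst).sub
        ((hfm f).comp measurable_snd)).abs.aestronglyMeasurable

end WeakConvergence

/-! ### Moments of the higher-level iterates -/

section Moments

open scoped BoundedContinuousFunction

variable {Ω S : Type*} [MeasurableSpace Ω] [MeasurableSpace S]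

/-- Taking first moments turns the higher-level map into the original one. -/
theorem firstMoment_higherMap (γ : RandomMap Ω S) (r : ProbabilityMeasure Ω)
    (ρ : ProbabilityMeasure (ProbabilityMeasure S)) :
    firstMoment (γ.higherMap r ρ) = γ.rdeMap r (firstMoment ρ) := by
  have hd : ∀ ω, γ.arity ω ≤ ⊤ := fun ω => le_top
  refine Subtype.ext (Measure.ext fun B hB => ?_)
  have h1 : (firstMoment (γ.higherMap r ρ) : Measure S) B =
      ∫⁻ ξ : ProbabilityMeasure S, (ξ : Measure S) B
        ∂(γ.higher.rdeMap r ρ : Measure (ProbabilityMeasure S)) :=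
    Measure.bind_apply hB measurable_subtype_coe.aemeasurable
  have hBm : Measurable fun ξ : ProbabilityMeasure S => (ξ : Measure S) B :=
    (Measure.measurable_coe hB).comp measurable_subtype_coe
  change (firstMoment (γ.higherMap r ρ) : Measure S) B =
    (γ.rdeMap r (firstMoment ρ) : Measure S) B
  rw [h1, γ.higher.rdeMap_eq_map_full hd, γ.rdeMap_eq_map_full hd,
    lintegral_map hBm (γ.higher.measurable_full hd),
    lintegral_prod (fun p => (γ.higher.full hd p.1 p.2 : Measure S) B)
      (hBm.comp (γ.higher.measurable_full hd)).aemeasurable,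
    Measure.map_apply (γ.measurable_full hd) hB, Measure.prod_apply (γ.measurable_full hd hB)]
  refine lintegral_congr fun ω => ?_
  have hC : MeasurableSet (γ.full hd ω ⁻¹' B) := γ.measurable_full_apply hd ω hB
  rw [← bind_infinitePi]
  refine Eq.trans ?_ (Measure.bind_apply hC
    measurable_infinitePi_probabilityMeasure.aemeasurable).symm
  refine lintegral_congr fun ξ => ?_
  rw [γ.higher_full, Measure.map_apply (γ.measurable_full_apply hd ω) hB]

theorem firstMoment_iterate_higherMap (γ : RandomMap Ω S) (r : ProbabilityMeasure Ω)
    {μ : ProbabilityMeasure S} (hμ : γ.rdeMap r μ = μ)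
    {ρ : ProbabilityMeasure (ProbabilityMeasure S)} (hρ : firstMoment ρ = μ) (t : ℕ) :
    firstMoment ((γ.higherMap r)^[t] ρ) = μ := by
  induction t with
  | zero => exact hρ
  | succ t ih => rw [Function.iterate_succ_apply', firstMoment_higherMap, ih, hμ]

/-- Among the laws with first moment measure `μ`, the point mass at `μ` gives the iterates of the
higher-level map with the smallest second moments: integrating out the random measures at the leaves
of the tree for fixed noise is a conditional expectation, to which Jensen's inequality applies. -/
theorem sq_integral_iterate_le [TopologicalSpace S] [SecondCountableTopology S]
    [TopologicalSpace.PseudoMetrizableSpace S] [BorelSpace S] (γ : RandomMap Ω S)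
    (r : ProbabilityMeasure Ω) {μ : ProbabilityMeasure S}
    {ρ : ProbabilityMeasure (ProbabilityMeasure S)} (hρ : firstMoment ρ = μ) (f : S →ᵇ ℝ) (t : ℕ) :
    ∫ ξ : ProbabilityMeasure S, (∫ x, f x ∂(ξ : Measure S)) ^ 2
      ∂((γ.higherMap r)^[t] (diracProba μ) : ProbabilityMeasure (ProbabilityMeasure S)) ≤
    ∫ ξ : ProbabilityMeasure S, (∫ x, f x ∂(ξ : Measure S)) ^ 2
      ∂((γ.higherMap r)^[t] ρ : ProbabilityMeasure (ProbabilityMeasure S)) := by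
  have hd : ∀ ω, γ.arity ω ≤ ⊤ := fun ω => le_top
  let Φ : (TreeWord ⊤ → Ω) × (TreeWord ⊤ → ProbabilityMeasure S) → ℝ := fun p =>
    ∫ x, f x ∂(γ.higher.treeEval hd t (fun i => (p.1 i, p.2 i)) : Measure S)
  have hfm : Measurable fun ξ : ProbabilityMeasure S => ∫ x, f x ∂(ξ : Measure S) :=
    (continuous_integral_probabilityMeasure f).measurable
  have hz : Measurable fun (p : (TreeWord ⊤ → Ω) × (TreeWord ⊤ → ProbabilityMeasure S))
      (i : TreeWord ⊤) => (p.1 i, p.2 i) := by fun_prop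
  have hΦ : Measurable Φ := hfm.comp ((γ.higher.measurable_treeEval hd t).comp hz)
  have hΦb : ∀ p, |Φ p| ≤ ‖f‖ := fun p => f.norm_integral_le_norm _
  have hΦint : ∀ (m : Measure ((TreeWord ⊤ → Ω) × (TreeWord ⊤ → ProbabilityMeasure S)))
      [IsProbabilityMeasure m], Integrable (fun p => Φ p ^ 2) m := fun m _ => by
    refine Integrable.of_bound (hΦ.pow_const 2).aestronglyMeasurable (‖f‖ ^ 2)
      (Eventually.of_forall fun p => ?_)
    rw [norm_pow]
    exact pow_le_pow_left₀ (norm_nonneg _) (hΦb p) 2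
  -- the second moment in terms of independent noise and independent measures at the leaves
  have key : ∀ ρ : ProbabilityMeasure (ProbabilityMeasure S),
      ∫ ξ : ProbabilityMeasure S, (∫ x, f x ∂(ξ : Measure S)) ^ 2
        ∂((γ.higherMap r)^[t] ρ : ProbabilityMeasure (ProbabilityMeasure S)) =
      ∫ w, ∫ ξ, Φ (w, ξ) ^ 2
        ∂(Measure.infinitePi fun _ : TreeWord ⊤ => (ρ : Measure (ProbabilityMeasure S)))
        ∂(Measure.infinitePi fun _ : TreeWord ⊤ => (r : Measure Ω)) := by
    intro ρ
    change ∫ ξ : ProbabilityMeasure S, (∫ x, f x ∂(ξ : Measure S)) ^ 2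
        ∂((γ.higher.rdeMap r)^[t] ρ : ProbabilityMeasure (ProbabilityMeasure S)) = _
    rw [← γ.higher.map_treeEval hd r ρ t, ← infinitePi_prod_map_zip,
      Measure.map_map (γ.higher.measurable_treeEval hd t) hz,
      integral_map ((γ.higher.measurable_treeEval hd t).comp hz).aemeasurable
        (hfm.pow_const 2).aestronglyMeasurable, integral_prod]
    · rfl
    · exact hΦint _
  have hmean : ∀ w, Φ (w, fun _ => μ) = ∫ ξ, Φ (w, ξ)
      ∂(Measure.infinitePi fun _ : TreeWord ⊤ => (ρ : Measure (ProbabilityMeasure S))) := by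
    intro w
    have hg : Measurable fun x : TreeWord ⊤ → S => γ.treeEval hd t fun i => (w i, x i) :=
      (γ.measurable_treeEval hd t).comp (by fun_prop)
    have hΦw : ∀ ξ, Φ (w, ξ) = ∫ x, f (γ.treeEval hd t fun i => (w i, x i))
        ∂(Measure.infinitePi fun i => (ξ i : Measure S)) := fun ξ => by
      simp only [Φ]
      rw [γ.higher_treeEval, integral_map hg.aemeasurable
        f.continuous.measurable.aestronglyMeasurable]
    simp_rw [hΦw]
    rw [← hρ, ← bind_infinitePi]
    let K : Kernel (TreeWord ⊤ → ProbabilityMeasure S) (TreeWord ⊤ → S) :=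
      ⟨fun ξ => Measure.infinitePi fun i => (ξ i : Measure S),
        measurable_infinitePi_probabilityMeasure⟩
    have hK : IsMarkovKernel K := ⟨fun ξ =>
      inferInstanceAs (IsProbabilityMeasure (Measure.infinitePi fun i => (ξ i : Measure S)))⟩
    have hfg : Measurable fun x : TreeWord ⊤ → S => f (γ.treeEval hd t fun i => (w i, x i)) :=
      f.continuous.measurable.comp hg
    have hsnd : ((Measure.infinitePi fun _ : TreeWord ⊤ =>
        (ρ : Measure (ProbabilityMeasure S))) ⊗ₘ K).snd =
        (Measure.infinitePi fun _ : TreeWord ⊤ => (ρ : Measure (ProbabilityMeasure S))).bind K :=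
      Measure.snd_compProd _ _
    change ∫ x, f (γ.treeEval hd t fun i => (w i, x i)) ∂((Measure.infinitePi fun _ : TreeWord ⊤ =>
      (ρ : Measure (ProbabilityMeasure S))).bind K) = _
    rw [← hsnd, Measure.snd, integral_map measurable_snd.aemeasurable hfg.aestronglyMeasurable,
      Measure.integral_compProd]
    · rfl
    · exact Integrable.of_bound (hfg.comp measurable_snd).aestronglyMeasurable ‖f‖
        (Eventually.of_forall fun x => f.norm_coe_le_norm _)
  rw [key, key]
  have hδ : (Measure.infinitePi fun _ : TreeWord ⊤ =>
      (diracProba μ : Measure (ProbabilityMeasure S))) = Measure.dirac fun _ => μ :=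
    Measure.infinitePi_dirac _
  refine integral_mono (hΦint _).integral_prod_left (hΦint _).integral_prod_left fun w => ?_
  have hΦw : Measurable fun ξ => Φ (w, ξ) := hΦ.comp measurable_prodMk_left
  simp only
  rw [hδ, integral_dirac' _ _ (hΦw.pow_const 2).stronglyMeasurable, hmean]
  exact sq_integral_le_integral_sq (MemLp.of_bound hΦw.aestronglyMeasurable ‖f‖
    (Eventually.of_forall fun ξ => hΦb (w, ξ)))

end Moments

/-! ### Conditional laws of the root of a recursive tree process -/

section RootLaw

open scoped BoundedContinuousFunction

theorem comap_pi_eq_iSup {ι E M : Type*} [mM : MeasurableSpace M] (W : ι → E → M) :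
    MeasurableSpace.comap (fun e i => W i e) MeasurableSpace.pi =
      ⨆ i, MeasurableSpace.comap (W i) mM := by
  simp only [MeasurableSpace.pi, MeasurableSpace.comap_iSup, MeasurableSpace.comap_comp]
  rfl

/-- The conditional law of the state at the root given all the noise. -/
noncomputable def rootLaw {Ω S E : Type*} [MeasurableSpace Ω] [MeasurableSpace S]
    [StandardBorelSpace S] [Nonempty S] [MeasurableSpace E] {d : ℕ∞} (P : Measure E)
    [IsProbabilityMeasure P] (W : TreeWord d → E → Ω) (X : TreeWord d → E → S) (e : E) :
    ProbabilityMeasure S :=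
  ⟨condDistrib (X []) (fun e i => W i e) P fun i => W i e, inferInstance⟩

namespace IsRecursiveTreeProcess

variable {Ω S E : Type*} [MeasurableSpace Ω] [MeasurableSpace S] [MeasurableSpace E]
  {γ : RandomMap Ω S} {r : ProbabilityMeasure Ω} {d : ℕ∞} {hd : ∀ ω, γ.arity ω ≤ d}
  {μ : ProbabilityMeasure S} {P : Measure E}
  {W : TreeWord d → E → Ω} {X : TreeWord d → E → S}

/-- The state at a vertex is computed from the states `t` generations below it. -/
theorem state_ae_eq_treeEval (h : IsRecursiveTreeProcess γ r d hd μ P W X) (t : ℕ)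
    (i : TreeWord d) :
    ∀ᵐ e ∂P, X i e = γ.treeEval hd t fun l => (W (i ++ l) e, X (i ++ l) e) := by
  induction t generalizing i with
  | zero => exact Eventually.of_forall fun e => by simp [RandomMap.treeEval]
  | succ t ih =>
    filter_upwards [h.recursion i, ae_all_iff.2 fun j : ArgIndex d => ih (i ++ [j])] with e h1 h2
    rw [h1]
    change γ.full hd (W i e) (fun j => X (i ++ [j]) e) = _
    simp only [RandomMap.treeEval, List.append_nil]
    congr 1
    funext j
    rw [h2 j]
    simp only [List.append_assoc, List.cons_append, List.nil_append]

theorem map_noise (h : IsRecursiveTreeProcess γ r d hd μ P W X) :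
    P.map (fun e i => W i e) = Measure.infinitePi fun _ : TreeWord d => (r : Measure Ω) := by
  rw [h.indep_noise.map_fun_eq_infinitePi_map h.measurable_noise]
  simp_rw [h.law_noise]

theorem map_state (h : IsRecursiveTreeProcess γ r d hd μ P W X) {t : ℕ} (ht : 1 ≤ t) :
    P.map (fun e (i : {i : TreeWord d // i.length = t}) => X i e) =
      Measure.infinitePi fun _ : {i : TreeWord d // i.length = t} => (μ : Measure S) := by
  rw [(h.indep_state t ht).map_fun_eq_infinitePi_map
    (X := fun i : {i : TreeWord d // i.length = t} => X i) fun i => h.measurable_state i]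
  congr 1
  funext i
  exact h.law_state t ht i i.2

/-- The state at the root has law `μ`. -/
theorem map_root [IsProbabilityMeasure P] (h : IsRecursiveTreeProcess γ r d hd μ P W X)
    (hμ : γ.rdeMap r μ = μ) : P.map (X []) = μ := by
  have h1 : IndepFun (W []) (fun e (j : ArgIndex d) => X [j] e) P :=
    ((h.indep_state_noise 1 le_rfl).comp
      (φ := fun (x : {i : TreeWord d // i.length = 1} → S) (j : ArgIndex d) => x ⟨[j], rfl⟩)
      (ψ := fun w : {i : TreeWord d // i.length < 1} → Ω => w ⟨[], by simp⟩)
      (by fun_prop) (by fun_prop)).symm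
  have h2 : P.map (fun e (j : ArgIndex d) => X [j] e) =
      Measure.infinitePi fun _ : ArgIndex d => (μ : Measure S) := by
    have hinj : Function.Injective
        (fun j : ArgIndex d => (⟨[j], rfl⟩ : {i : TreeWord d // i.length = 1})) := fun i j hij => by
      simpa using hij
    rw [← Measure.map_infinitePi_infinitePi_of_inj
      (P := fun _ : {i : TreeWord d // i.length = 1} => (μ : Measure S)) hinj,
      ← h.map_state le_rfl, Measure.map_map (by fun_prop)
        (measurable_pi_lambda _ fun i : {i : TreeWord d // i.length = 1} =>
          h.measurable_state i)]
    rfl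
  have hX : Measurable fun e (j : ArgIndex d) => X [j] e :=
    measurable_pi_lambda _ fun j => h.measurable_state _
  have h3 : X [] =ᵐ[P] (fun p : Ω × (ArgIndex d → S) => γ.full hd p.1 p.2) ∘
      fun e => (W [] e, fun j => X [j] e) := h.recursion []
  rw [Measure.map_congr h3, ← Measure.map_map (γ.measurable_full hd)
      ((h.measurable_noise []).prodMk hX),
    h1.map_prod_eq_prod_map_map (h.measurable_noise []).aemeasurable hX.aemeasurable,
    h2, h.law_noise, ← γ.rdeMap_eq_map_full hd, hμ]

/-- The conditional law of the state at the root given the noise above level `t`, as a function of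
the noise, has law `Ťᵗ(δ_μ)`. -/
theorem map_higher_treeEval (h : IsRecursiveTreeProcess γ r d hd μ P W X) (t : ℕ) :
    P.map (fun e => γ.higher.treeEval hd t fun i => (W i e, μ)) =
      ((γ.higherMap r)^[t] (diracProba μ) : ProbabilityMeasure (ProbabilityMeasure S)) := by
  have hW : Measurable fun e i => W i e := measurable_pi_lambda _ h.measurable_noise
  have h1 : (Measure.infinitePi fun _ : TreeWord d => (r : Measure Ω)).map
      (fun w i => (w i, μ)) = Measure.infinitePi fun _ : TreeWord d =>
        (r : Measure Ω).prod (diracProba μ : Measure (ProbabilityMeasure S)) := by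
    rw [Measure.infinitePi_map_pi (f := fun _ ω => (ω, μ)) _ fun _ => by fun_prop]
    congr 1
    funext i
    exact (Measure.prod_dirac μ).symm
  have h2 := γ.higher.map_treeEval hd r (diracProba μ) t
  rw [← h1, Measure.map_map (γ.higher.measurable_treeEval hd t) (by fun_prop), ← h.map_noise,
    Measure.map_map ((γ.higher.measurable_treeEval hd t).comp (by fun_prop)) hW] at h2
  exact h2

variable [IsProbabilityMeasure P]

/-- Given the noise above level `t`, the state at the root is a function of independent states at
level `t` with law `μ`. -/
theorem condExp_root_ae_eq [TopologicalSpace S] [PolishSpace S] [BorelSpace S]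
    (h : IsRecursiveTreeProcess γ r d hd μ P W X) {t : ℕ} (ht : 1 ≤ t) (f : S →ᵇ ℝ) :
    P[fun e => f (X [] e) | MeasurableSpace.comap
      (fun e (i : {i : TreeWord d // i.length < t}) => W i e) MeasurableSpace.pi] =ᵐ[P]
      fun e => ∫ x, f x ∂(γ.higher.treeEval hd t (fun i => (W i e, μ)) : Measure S) := by
  obtain ⟨ω₀⟩ : Nonempty Ω := (r : Measure Ω).nonempty_of_neZero
  obtain ⟨s₀⟩ : Nonempty S := (μ : Measure S).nonempty_of_neZero
  have : Nonempty S := ⟨s₀⟩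
  let U : E → {i : TreeWord d // i.length < t} → Ω := fun e i => W i e
  let V : E → {i : TreeWord d // i.length = t} → S := fun e i => X i e
  have hU : Measurable U := measurable_pi_lambda _ fun i => h.measurable_noise i
  have hV : Measurable V := measurable_pi_lambda _ fun i => h.measurable_state i
  -- fill up with arbitrary values where `treeEval t` does not look
  let glue : ({i : TreeWord d // i.length < t} → Ω) × ({i : TreeWord d // i.length = t} → S) →
      TreeWord d → Ω × S := fun p i =>
    (if hi : i.length < t then p.1 ⟨i, hi⟩ else ω₀, if hi : i.length = t then p.2 ⟨i, hi⟩ else s₀)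
  have hglue : Measurable glue := by
    refine measurable_pi_lambda _ fun i => Measurable.prodMk ?_ ?_
    · by_cases hi : i.length < t <;> simp only [hi, dite_true, dite_false] <;> fun_prop
    · by_cases hi : i.length = t <;> simp only [hi, dite_true, dite_false] <;> fun_prop
  let Φ : ({i : TreeWord d // i.length < t} → Ω) × ({i : TreeWord d // i.length = t} → S) → ℝ :=
    fun p => f (γ.treeEval hd t (glue p))
  have hΦ : Measurable Φ :=
    f.continuous.measurable.comp ((γ.measurable_treeEval hd t).comp hglue)
  have hΦb : ∀ p, ‖Φ p‖ ≤ ‖f‖ := fun p => f.norm_coe_le_norm _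
  have h1 : (fun e => f (X [] e)) =ᵐ[P] fun e => Φ (U e, V e) := by
    filter_upwards [h.state_ae_eq_treeEval t []] with e he
    rw [he]
    simp only [Φ]
    congr 1
    refine γ.treeEval_congr hd (fun i hi => ?_) fun i hi => ?_
    · simp [glue, U, hi]
    · simp [glue, V, hi]
  have h2 : condDistrib V U P =ᵐ[P.map U] Kernel.const _ (P.map V) := by
    refine condDistrib_ae_eq_of_measure_eq_compProd U hV.aemeasurable ?_
    rw [Measure.compProd_const]
    exact (h.indep_state_noise t ht).symm.map_prod_eq_prod_map_map hU.aemeasurable hV.aemeasurable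
  have h3 := condExp_prod_ae_eq_integral_condDistrib (μ := P) hU hV.aemeasurable
    hΦ.stronglyMeasurable (Integrable.of_bound (hΦ.comp (hU.prodMk hV)).aestronglyMeasurable ‖f‖
      (Eventually.of_forall fun e => hΦb _))
  refine (condExp_congr_ae h1).trans (h3.trans ?_)
  filter_upwards [ae_of_ae_map hU.aemeasurable h2] with e he
  have hg : Measurable fun x : TreeWord d → S => γ.treeEval hd t fun i => (W i e, x i) :=
    (γ.measurable_treeEval hd t).comp (by fun_prop)
  have hΦe : Measurable fun v => Φ (U e, v) := hΦ.comp measurable_prodMk_left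
  rw [he, Kernel.const_apply, h.map_state ht, γ.higher_treeEval,
    ← Measure.map_infinitePi_infinitePi_of_inj (P := fun _ : TreeWord d => (μ : Measure S))
      (f := fun i : {i : TreeWord d // i.length = t} => (i : TreeWord d)) Subtype.val_injective,
    integral_map (Measurable.aemeasurable (by fun_prop)) hΦe.aestronglyMeasurable,
    integral_map hg.aemeasurable f.continuous.measurable.aestronglyMeasurable]
  refine integral_congr_ae (Eventually.of_forall fun x => ?_)
  simp only [Φ]
  congr 1
  refine γ.treeEval_congr hd (fun i hi => ?_) fun i hi => ?_
  · simp [glue, U, hi]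
  · simp [glue, hi]

variable [TopologicalSpace S] [PolishSpace S] [BorelSpace S] [Nonempty S]

theorem measurable_rootLaw (h : IsRecursiveTreeProcess γ r d hd μ P W X) :
    Measurable (rootLaw P W X) :=
  Measurable.subtype_mk ((Kernel.measurable _).comp (measurable_pi_lambda _ h.measurable_noise))

/-- The integral of a bounded function against the conditional law of the root is its conditional
expectation. -/
theorem condExp_root_ae_eq_rootLaw (h : IsRecursiveTreeProcess γ r d hd μ P W X) {f : S → ℝ}
    (hf : Measurable f) {C : ℝ} (hC : ∀ x, |f x| ≤ C) :
    P[fun e => f (X [] e) | MeasurableSpace.comap (fun e i => W i e) MeasurableSpace.pi] =ᵐ[P]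
      fun e => ∫ x, f x ∂(rootLaw P W X e : Measure S) :=
  condExp_ae_eq_integral_condDistrib (measurable_pi_lambda _ h.measurable_noise)
    (h.measurable_state []).aemeasurable hf.stronglyMeasurable
    (Integrable.of_bound (hf.comp (h.measurable_state [])).aestronglyMeasurable C
      (Eventually.of_forall fun _ => hC _))

/-- The iterates `Ťᵗ(δ_μ)` tend to the law of the conditional law of the root given the noise, by
Lévy's upward theorem. -/
theorem tendsto_iterate_higherMap (h : IsRecursiveTreeProcess γ r d hd μ P W X)
    {ν : ProbabilityMeasure (ProbabilityMeasure S)} (hν : P.map (rootLaw P W X) = ν) :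
    Tendsto (fun t : ℕ => (γ.higherMap r)^[t] (diracProba μ)) atTop (𝓝 ν) := by
  let ξ : ℕ → E → ProbabilityMeasure S := fun t e =>
    γ.higher.treeEval hd t fun i => (W i e, μ)
  have hW : Measurable fun e i => W i e := measurable_pi_lambda _ h.measurable_noise
  have hξ : ∀ t, Measurable (ξ t) := fun t =>
    ((γ.higher.measurable_treeEval hd t).comp (f := fun e i => (W i e, μ))
      (measurable_pi_lambda _ fun i => (h.measurable_noise i).prodMk measurable_const))
  have hpair : ∀ t, Measurable fun e => (ξ t e, rootLaw P W X e) := fun t =>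
    (hξ t).prodMk h.measurable_rootLaw
  refine tendsto_law_of_coupling (fun t => P.map fun e => (ξ t e, rootLaw P W X e))
    (fun t => ?_) (fun t => ?_) fun f => ?_
  · rw [Measure.map_map measurable_fst (hpair t)]
    exact h.map_higher_treeEval t
  · rw [Measure.map_map measurable_snd (hpair t)]
    exact hν
  -- the filtration generated by the noise above level `t`
  let ℱ : Filtration ℕ (inferInstance : MeasurableSpace E) :=
    { seq := fun t => MeasurableSpace.comap
        (fun e (i : {i : TreeWord d // i.length < t}) => W i e) MeasurableSpace.pi
      mono' := fun s t hst => by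
        simp only [comap_pi_eq_iSup]
        exact iSup_le fun i => le_iSup (fun i : {i : TreeWord d // i.length < t} =>
          MeasurableSpace.comap (W i) inferInstance) ⟨i, i.2.trans_le hst⟩
      le' := fun t => (measurable_pi_lambda _ fun i : {i : TreeWord d // i.length < t} =>
        h.measurable_noise i).comap_le }
  have hsup : ⨆ t, ℱ t = MeasurableSpace.comap (fun e i => W i e) MeasurableSpace.pi := by
    change ⨆ t, MeasurableSpace.comap (fun e (i : {i : TreeWord d // i.length < t}) => W i e)
      MeasurableSpace.pi = _
    simp only [comap_pi_eq_iSup]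
    refine le_antisymm (iSup_le fun t => iSup_le fun i => le_iSup (fun i : TreeWord d =>
      MeasurableSpace.comap (W i) inferInstance) i) (iSup_le fun i => ?_)
    exact le_iSup_of_le (i.length + 1) (le_iSup
      (fun l : {l : TreeWord d // l.length < i.length + 1} =>
        MeasurableSpace.comap (W l) inferInstance) ⟨i, Nat.lt_succ_self _⟩)
  have hL := tendsto_eLpNorm_condExp (μ := P) (ℱ := ℱ) fun e => f (X [] e)
  rw [hsup] at hL
  have hL' := (ENNReal.tendsto_toReal ENNReal.zero_ne_top).comp hL
  rw [ENNReal.toReal_zero] at hL'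
  refine hL'.congr' ?_
  filter_upwards [eventually_ge_atTop 1] with t ht
  have hfm := (continuous_integral_probabilityMeasure f).measurable
  have habs : Measurable fun p : ProbabilityMeasure S × ProbabilityMeasure S =>
      |∫ x, f x ∂(p.1 : Measure S) - ∫ x, f x ∂(p.2 : Measure S)| :=
    ((hfm.comp measurable_fst).sub (hfm.comp measurable_snd)).abs
  rw [integral_map (hpair t).aemeasurable habs.aestronglyMeasurable]
  simp only [Function.comp_apply]
  rw [eLpNorm_one_eq_lintegral_enorm, ← integral_norm_eq_lintegral_enorm
    (integrable_condExp.sub integrable_condExp).aestronglyMeasurable]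
  refine integral_congr_ae ?_
  filter_upwards [h.condExp_root_ae_eq ht f, h.condExp_root_ae_eq_rootLaw
    f.continuous.measurable f.norm_coe_le_norm] with e h1 h2
  rw [Pi.sub_apply, h2, ← h1]
  rfl

/-- The law of the conditional law of the root has first moment measure `μ`. -/
theorem firstMoment_law_rootLaw (h : IsRecursiveTreeProcess γ r d hd μ P W X)
    (hμ : γ.rdeMap r μ = μ) {ν : ProbabilityMeasure (ProbabilityMeasure S)}
    (hν : P.map (rootLaw P W X) = ν) : firstMoment ν = μ := by
  refine Subtype.ext ?_
  change Measure.bind (ν : Measure (ProbabilityMeasure S)) (fun ξ => (ξ : Measure S)) =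
    (μ : Measure S)
  have hW : Measurable fun e i => W i e := measurable_pi_lambda _ h.measurable_noise
  have h1 := condDistrib_comp_map (μ := P) hW.aemeasurable (h.measurable_state []).aemeasurable
  rw [h.map_root hμ] at h1
  rw [← h1, ← hν]
  ext B hB
  have hBm : Measurable fun ξ : ProbabilityMeasure S => (ξ : Measure S) B :=
    (Measure.measurable_coe hB).comp measurable_subtype_coe
  have h2 : ((P.map (rootLaw P W X)).bind fun ξ : ProbabilityMeasure S => (ξ : Measure S)) B =
      ∫⁻ ξ : ProbabilityMeasure S, (ξ : Measure S) B ∂P.map (rootLaw P W X) :=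
    Measure.bind_apply hB measurable_subtype_coe.aemeasurable
  rw [h2, lintegral_map hBm h.measurable_rootLaw, Measure.bind_apply hB (Kernel.aemeasurable _),
    lintegral_map (Kernel.measurable_coe _ hB) hW]
  rfl

/-- Endogeny means that the conditional law of the root given the noise is a point mass. -/
theorem isEndogenous_iff_law_rootLaw (h : IsRecursiveTreeProcess γ r d hd μ P W X)
    (hμ : γ.rdeMap r μ = μ) {ν : ProbabilityMeasure (ProbabilityMeasure S)}
    (hν : P.map (rootLaw P W X) = ν) : IsEndogenous P W X ↔ ν = diracLaw μ := by
  have hW : Measurable fun e i => W i e := measurable_pi_lambda _ h.measurable_noise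
  have hdirac : Measurable (diracProba : S → ProbabilityMeasure S) :=
    Measurable.subtype_mk Measure.measurable_dirac
  constructor
  · rintro ⟨Y, hY, hXY⟩
    rw [← comap_pi_eq_iSup] at hY
    obtain ⟨φ, hφ, rfl⟩ := hY.exists_eq_measurable_comp
    have h1 : condDistrib (X []) (fun e i => W i e) P =ᵐ[P.map fun e i => W i e]
        Kernel.deterministic φ hφ := by
      rw [condDistrib_congr_left hXY]
      exact condDistrib_comp_self _ hφ
    have h2 : rootLaw P W X =ᵐ[P] fun e => diracProba (X [] e) := by
      filter_upwards [ae_of_ae_map hW.aemeasurable h1, hXY] with e he hXe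
      refine Subtype.ext ?_
      rw [hXe]
      exact he.trans (Kernel.deterministic_apply hφ _)
    refine Subtype.ext ?_
    change (ν : Measure (ProbabilityMeasure S)) = (μ : Measure S).map diracProba
    rw [← hν, Measure.map_congr h2, ← h.map_root hμ,
      Measure.map_map hdirac (h.measurable_state [])]
    rfl
  · intro hνμ
    -- `f` is a bounded injective coordinate on `S`
    let f : S → ℝ := fun x => unitInterval.sigmoid (embeddingReal S x)
    have hf : MeasurableEmbedding f := (MeasurableEmbedding.subtype_coe measurableSet_Icc).comp
      (measurableEmbedding_sigmoid_comp_embeddingReal S)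
    have hfb : ∀ x, |f x| ≤ 1 := fun x => by
      have := (unitInterval.sigmoid (embeddingReal S x)).2
      exact abs_le.2 ⟨by linarith [this.1], this.2⟩
    let g : E → ℝ := fun e => ∫ x, f x ∂(rootLaw P W X e : Measure S)
    have hgW : StronglyMeasurable[MeasurableSpace.comap (fun e i => W i e) MeasurableSpace.pi] g :=
      (StronglyMeasurable.integral_condDistrib (X := fun e i => W i e) (Y := X []) (μ := P)
        (f := fun p => f p.2) (hf.measurable.comp
          measurable_snd).stronglyMeasurable).comp_measurable (comap_measurable _)
    have hg : Measurable g := (hgW.mono hW.comap_le).measurable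
    have hgb : ∀ e, |g e| ≤ 1 := fun e => by
      have := norm_integral_le_of_norm_le_const (μ := (rootLaw P W X e : Measure S)) (f := f)
        (Eventually.of_forall hfb)
      simpa using this
    have hfX : Measurable fun e => f (X [] e) := hf.measurable.comp (h.measurable_state [])
    have hint : ∀ {u v : E → ℝ}, Measurable u → Measurable v → (∀ e, |u e| ≤ 1) →
        (∀ e, |v e| ≤ 1) → Integrable (fun e => u e * v e) P := fun hu hv hub hvb =>
      Integrable.of_bound (hu.mul hv).aestronglyMeasurable (1 * 1) (Eventually.of_forall fun e => by
        rw [norm_mul]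
        exact mul_le_mul (hub e) (hvb e) (norm_nonneg _) zero_le_one)
    have e1 : ∫ e, g e * f (X [] e) ∂P = ∫ e, g e * g e ∂P := by
      rw [← integral_condExp hW.comap_le]
      refine integral_congr_ae ?_
      refine (condExp_mul_of_stronglyMeasurable_left hgW (hint hg hfX hgb fun e => hfb _)
        (Integrable.of_bound hfX.aestronglyMeasurable 1
          (Eventually.of_forall fun e => hfb _))).trans ?_
      filter_upwards [h.condExp_root_ae_eq_rootLaw hf.measurable hfb] with e he
      rw [Pi.mul_apply, he]
    -- the second moments of `f (X [])` and of its conditional expectation agree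
    have e2 : ∫ e, g e * g e ∂P = ∫ e, f (X [] e) * f (X [] e) ∂P := by
      have hm : Measurable fun ξ : ProbabilityMeasure S => ∫ x, f x ∂(ξ : Measure S) :=
        (StronglyMeasurable.integral_kernel (κ := (⟨fun ξ => ξ, measurable_subtype_coe⟩ :
          Kernel (ProbabilityMeasure S) S)) hf.measurable.stronglyMeasurable).measurable
      have hm2 : Measurable fun ξ : ProbabilityMeasure S =>
          (∫ x, f x ∂(ξ : Measure S)) * ∫ x, f x ∂(ξ : Measure S) := hm.mul hm
      have e3 : ∫ e, g e * g e ∂P = ∫ ξ : ProbabilityMeasure S, (∫ x, f x ∂(ξ : Measure S)) *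
          (∫ x, f x ∂(ξ : Measure S)) ∂(ν : Measure (ProbabilityMeasure S)) := by
        rw [← hν, integral_map h.measurable_rootLaw.aemeasurable hm2.aestronglyMeasurable]
      have e4 : (ν : Measure (ProbabilityMeasure S)) = P.map fun e => diracProba (X [] e) := by
        rw [hνμ]
        change (μ : Measure S).map diracProba = _
        rw [← h.map_root hμ, Measure.map_map hdirac (h.measurable_state [])]
        rfl
      have hδX : Measurable fun e => diracProba (X [] e) := hdirac.comp (h.measurable_state [])
      rw [e3, e4, integral_map hδX.aemeasurable hm2.aestronglyMeasurable]
      refine integral_congr_ae (Eventually.of_forall fun e => ?_)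
      have : ∫ x, f x ∂(diracProba (X [] e) : Measure S) = f (X [] e) :=
        integral_dirac' _ _ hf.measurable.stronglyMeasurable
      simp only [this]
    have e5 : ∫ e, (f (X [] e) - g e) ^ 2 ∂P = 0 := by
      have : ∀ e, (f (X [] e) - g e) ^ 2 =
          f (X [] e) * f (X [] e) - 2 * (g e * f (X [] e)) + g e * g e := fun e => by ring
      simp_rw [this]
      have i1 := hint hfX hfX (fun e => hfb _) fun e => hfb _
      have i2 := (hint hg hfX hgb fun e => hfb _).const_mul 2
      have i12 : Integrable (fun e => f (X [] e) * f (X [] e) - 2 * (g e * f (X [] e))) P :=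
        i1.sub i2
      rw [integral_add i12 (hint hg hg hgb hgb), integral_sub i1 i2, integral_const_mul, e1, e2]
      ring
    have e6 : ∀ᵐ e ∂P, f (X [] e) = g e := by
      have h2 := (integral_eq_zero_iff_of_nonneg (fun e => sq_nonneg (f (X [] e) - g e))
        (Integrable.of_bound ((hfX.sub hg).pow_const 2).aestronglyMeasurable 4
          (Eventually.of_forall fun e => by
            rw [norm_pow, Real.norm_eq_abs]
            have := (abs_sub (f (X [] e)) (g e)).trans (add_le_add (hfb _) (hgb e))
            nlinarith [abs_nonneg (f (X [] e) - g e)]))).1 e5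
      filter_upwards [h2] with e he
      exact sub_eq_zero.1 (pow_eq_zero_iff two_ne_zero |>.1 he)
    refine ⟨fun e => hf.invFun (g e), ?_, ?_⟩
    · rw [← comap_pi_eq_iSup]
      exact hf.measurable_invFun.comp hgW.measurable
    · filter_upwards [e6] with e he
      rw [← he, hf.leftInverse_invFun]

end IsRecursiveTreeProcess

end RootLaw

/-! ### Existence of recursive tree processes -/

section Existence

open scoped unitInterval

/-- If `T(μ) = μ`, then a state with law `μ` can be written as `γ[ω](x)` with `ω` and `x` functions
of the state and an independent uniform variable, in such a way that `(ω, x)` has the law of the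
noise and independent states with law `μ`. -/
theorem exists_resolution {Ω S : Type*} [MeasurableSpace Ω] [StandardBorelSpace Ω]
    [MeasurableSpace S] [StandardBorelSpace S] (γ : RandomMap Ω S) (r : ProbabilityMeasure Ω)
    {d : ℕ∞} (hd : ∀ ω, γ.arity ω ≤ d) {μ : ProbabilityMeasure S} (hμ : γ.rdeMap r μ = μ) :
    ∃ k : S × I → Ω × (ArgIndex d → S), Measurable k ∧
      ((μ : Measure S).prod volume).map k =
        (r : Measure Ω).prod (Measure.infinitePi fun _ : ArgIndex d => (μ : Measure S)) ∧
      ∀ᵐ p ∂(μ : Measure S).prod (volume : Measure I), p.1 = γ.full hd (k p).1 (k p).2 := by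
  have : Nonempty Ω := (r : Measure Ω).nonempty_of_neZero
  have : Nonempty S := (μ : Measure S).nonempty_of_neZero
  let ν : Measure (Ω × (ArgIndex d → S)) :=
    (r : Measure Ω).prod (Measure.infinitePi fun _ : ArgIndex d => (μ : Measure S))
  let G : Ω × (ArgIndex d → S) → S := fun p => γ.full hd p.1 p.2
  have hG : Measurable G := γ.measurable_full hd
  have hν : ν.map G = μ := by
    rw [← γ.rdeMap_eq_map_full hd, hμ]
  obtain ⟨k, hk, hkK⟩ := (condDistrib id G ν).exists_measurable_map_eq_unitInterval
  have hk' : Measurable fun p : S × I => (p.1, Function.uncurry k p) := measurable_fst.prodMk hk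
  have hjoint : ((μ : Measure S).prod volume).map (fun p => (p.1, Function.uncurry k p)) =
      ν.map fun q => (G q, q) := by
    have h1 := compProd_map_condDistrib (X := G) (μ := ν) (Y := id)
      (mβ := inferInstance) aemeasurable_id
    rw [hν] at h1
    refine Eq.trans ?_ h1
    ext B hB
    rw [Measure.map_apply hk' hB, Measure.prod_apply (hk' hB), Measure.compProd_apply hB]
    refine lintegral_congr fun s => ?_
    have hks : Measurable (k s) := hk.comp measurable_prodMk_left
    rw [← hkK s, Measure.map_apply hks (measurable_prodMk_left hB)]
    rfl
  have hGq : Measurable fun q => (G q, q) := hG.prodMk measurable_id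
  refine ⟨Function.uncurry k, hk, ?_, ?_⟩
  · have h2 := congrArg (Measure.map Prod.snd) hjoint
    rw [Measure.map_map measurable_snd hk', Measure.map_map measurable_snd hGq] at h2
    exact h2.trans Measure.map_id
  · have hE : MeasurableSet {p : S × (Ω × (ArgIndex d → S)) | p.1 = G p.2} :=
      measurableSet_eq_fun measurable_fst (hG.comp measurable_snd)
    have h3 : ∀ᵐ p ∂ν.map (fun q => (G q, q)), p.1 = G p.2 :=
      (ae_map_iff hGq.aemeasurable hE).2 (Eventually.of_forall fun q => rfl)
    rw [← hjoint] at h3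
    exact ae_of_ae_map hk'.aemeasurable h3

variable {A Ω S : Type*} [MeasurableSpace Ω] [MeasurableSpace S]

/-- The seed of the subtree rooted at the letter `j`, when `k` resolves states into noise and states
of the children: the state at the root is resolved with the help of the uniform variable there. -/
def childSeed (k : S × I → Ω × (A → S)) (j : A) (p : S × (List A → I)) : S × (List A → I) :=
  ((k (p.1, p.2 [])).2 j, fun i => p.2 (j :: i))

/-- The noise and the state at each vertex of the tree that arises from the state `p.1` at the root
by resolving each state with the help of the uniform variable `p.2 i` at its vertex. -/
def unfoldTree (k : S × I → Ω × (A → S)) : S × (List A → I) → List A → Ω × S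
  | p, [] => ((k (p.1, p.2 [])).1, p.1)
  | p, j :: i => unfoldTree k (childSeed k j p) i

/-- The law of the seed of a tree: a state and independent uniform variables. -/
noncomputable def seedLaw (A : Type*) (μ : ProbabilityMeasure S) : Measure (S × (List A → I)) :=
  (μ : Measure S).prod (Measure.infinitePi fun _ : List A => (volume : Measure I))

instance isProbabilityMeasure_seedLaw (μ : ProbabilityMeasure S) :
    IsProbabilityMeasure (seedLaw A μ) :=
  inferInstanceAs (IsProbabilityMeasure ((μ : Measure S).prod _))

theorem measurable_childSeed {k : S × I → Ω × (A → S)} (hk : Measurable k) (j : A) :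
    Measurable (childSeed k j) := by
  refine Measurable.prodMk ?_ (by fun_prop)
  exact (measurable_pi_apply j).comp (measurable_snd.comp (hk.comp (by fun_prop)))

theorem measurable_unfoldTree {k : S × I → Ω × (A → S)} (hk : Measurable k) :
    Measurable (unfoldTree k) := by
  refine measurable_pi_lambda _ fun i => ?_
  induction i with
  | nil => exact (measurable_fst.comp (hk.comp (by fun_prop))).prodMk measurable_fst
  | cons j i ih => exact ih.comp (measurable_childSeed hk j)

/-- The noise at the root and the seeds of the children are independent. -/
theorem map_noise_childSeed {k : S × I → Ω × (A → S)} (hk : Measurable k)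
    {r : ProbabilityMeasure Ω} {μ : ProbabilityMeasure S}
    (hkr : ((μ : Measure S).prod volume).map k =
      (r : Measure Ω).prod (Measure.infinitePi fun _ : A => (μ : Measure S))) :
    (seedLaw A μ).map (fun p => ((k (p.1, p.2 [])).1, fun j => childSeed k j p)) =
      (r : Measure Ω).prod (Measure.infinitePi fun _ : A => seedLaw A μ) := by
  have h1 := infinitePi_map_root_subtrees fun _ : List A => (volume : Measure I)
  have hz : Measurable fun (q : (A → S) × (A → List A → I)) (j : A) => (q.1 j, q.2 j) := by fun_prop
  have hs : Measurable fun z : List A → I => (z [], fun (j : A) (i : List A) => z (j :: i)) := by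
    fun_prop
  have e : (fun p : S × (List A → I) => ((k (p.1, p.2 [])).1, fun j => childSeed k j p)) =
      Prod.map id (fun (q : (A → S) × (A → List A → I)) (j : A) => (q.1 j, q.2 j)) ∘
      MeasurableEquiv.prodAssoc ∘ Prod.map k id ∘ MeasurableEquiv.prodAssoc.symm ∘
      Prod.map id fun z : List A → I => (z [], fun (j : A) (i : List A) => z (j :: i)) := rfl
  rw [e, ← Measure.map_map (measurable_id.prodMap hz) (by fun_prop),
    ← Measure.map_map (by fun_prop) (by fun_prop), ← Measure.map_map (by fun_prop) (by fun_prop),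
    ← Measure.map_map (by fun_prop) (by fun_prop), seedLaw,
    ← Measure.map_prod_map _ _ measurable_id hs, h1, Measure.map_id,
    ← Measure.prodAssoc_prod, MeasurableEquiv.map_symm_map,
    ← Measure.map_prod_map _ _ hk measurable_id, hkr, Measure.map_id, Measure.prodAssoc_prod,
    ← Measure.map_prod_map _ _ measurable_id hz, infinitePi_prod_map_zip, Measure.map_id]

/-- The seeds of the children have the law of the seed at the root. -/
theorem map_childSeed {k : S × I → Ω × (A → S)} (hk : Measurable k)
    {r : ProbabilityMeasure Ω} {μ : ProbabilityMeasure S}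
    (hkr : ((μ : Measure S).prod volume).map k =
      (r : Measure Ω).prod (Measure.infinitePi fun _ : A => (μ : Measure S))) (j : A) :
    (seedLaw A μ).map (childSeed k j) = seedLaw A μ := by
  have h := congrArg (fun m : Measure (Ω × (A → S × (List A → I))) =>
    Measure.map (fun z => z j) (m.map Prod.snd)) (map_noise_childSeed hk hkr)
  beta_reduce at h
  have hm : Measurable fun p : S × (List A → I) =>
      ((k (p.1, p.2 [])).1, fun j => childSeed k j p) :=
    (measurable_fst.comp (hk.comp (by fun_prop))).prodMk
      (measurable_pi_lambda _ fun j => measurable_childSeed hk j)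
  rw [Measure.map_map measurable_snd hm, Measure.map_map (by fun_prop) (measurable_snd.comp hm),
    Measure.map_snd_prod, measure_univ, one_smul, Measure.infinitePi_map_eval] at h
  exact h

/-- Keep the noise above level `t` and the states at level `t`, and replace everything else by
constants. -/
def cut (c : Ω × S) (t : ℕ) (z : List A → Ω × S) (i : List A) : Ω × S :=
  (if i.length < t then (z i).1 else c.1, if i.length = t then (z i).2 else c.2)

theorem measurable_cut_apply (c : Ω × S) (t n : ℕ) : Measurable fun y : Ω × S =>
    ((if n < t then y.1 else c.1, if n = t then y.2 else c.2) : Ω × S) := by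
  refine Measurable.prodMk ?_ ?_
  · by_cases hi : n < t <;> simp only [hi, if_true, if_false] <;> fun_prop
  · by_cases hi : n = t <;> simp only [hi, if_true, if_false] <;> fun_prop

theorem measurable_cut (c : Ω × S) (t : ℕ) : Measurable (cut (A := A) c t) :=
  measurable_pi_lambda _ fun i => (measurable_cut_apply c t i.length).comp (measurable_pi_apply i)

/-- In the unfolded tree, the noise above level `t` and the states at level `t` are independent. -/
theorem map_cut_unfoldTree {k : S × I → Ω × (A → S)} (hk : Measurable k)
    {r : ProbabilityMeasure Ω} {μ : ProbabilityMeasure S}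
    (hkr : ((μ : Measure S).prod volume).map k =
      (r : Measure Ω).prod (Measure.infinitePi fun _ : A => (μ : Measure S)))
    (c : Ω × S) (t : ℕ) :
    (seedLaw A μ).map (fun p => cut c t (unfoldTree k p)) =
      (Measure.infinitePi fun _ : List A => (r : Measure Ω).prod (μ : Measure S)).map
        (cut c t) := by
  -- the law of the vertex `i` of the cut tree
  let m : ℕ → List A → Measure (Ω × S) := fun t i => ((r : Measure Ω).prod (μ : Measure S)).map
    fun y => (if i.length < t then y.1 else c.1, if i.length = t then y.2 else c.2)
  have hm : ∀ t i, IsProbabilityMeasure (m t i) := fun t i =>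
    Measure.isProbabilityMeasure_map (measurable_cut_apply c t i.length).aemeasurable
  have hcut : ∀ t, (Measure.infinitePi fun _ : List A => (r : Measure Ω).prod (μ : Measure S)).map
      (cut c t) = Measure.infinitePi (m t) := fun t =>
    Measure.infinitePi_map_pi _ fun i : List A => measurable_cut_apply c t i.length
  rw [hcut]
  have hglue : Measurable fun (p : (Ω × S) × (A → List A → Ω × S)) (i : List A) =>
      (i.casesOn p.1 fun j i => p.2 j i : Ω × S) := by
    refine measurable_pi_lambda _ fun i => ?_
    cases i <;> fun_prop
  induction t with
  | zero =>
    have hroot : m 0 [] = (μ : Measure S).map fun s => (c.1, s) := by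
      have : (fun y : Ω × S => (c.1, y.2)) = (fun s => (c.1, s)) ∘ Prod.snd := rfl
      simp only [m, List.length_nil, lt_self_iff_false, if_false, if_true]
      rw [this, ← Measure.map_map (by fun_prop) measurable_snd, Measure.map_snd_prod]
      simp
    have hsub : (Measure.infinitePi fun j : A => Measure.infinitePi fun i => m 0 (j :: i)) =
        Measure.dirac fun _ _ => c := by
      have : ∀ (j : A) (i : List A), m 0 (j :: i) = Measure.dirac c := fun j i => by
        simp [m]
      simp_rw [this, Measure.infinitePi_dirac]
    have e : (fun p => cut c 0 (unfoldTree k p)) =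
        (fun (p : (Ω × S) × (A → List A → Ω × S)) (i : List A) =>
          (i.casesOn p.1 fun j i => p.2 j i : Ω × S)) ∘ (fun y => (y, fun _ _ => c)) ∘
          (fun s => (c.1, s)) ∘ Prod.fst := by
      funext p i
      cases i <;> simp [cut, unfoldTree]
    rw [← infinitePi_eq_map_root_subtrees, hroot, hsub, Measure.prod_dirac, e,
      ← Measure.map_map hglue (by fun_prop), ← Measure.map_map (by fun_prop) (by fun_prop),
      ← Measure.map_map (by fun_prop) (by fun_prop), seedLaw, Measure.map_fst_prod]
    simp
  | succ t ih =>
    have hroot : m (t + 1) [] = (r : Measure Ω).map fun ω => (ω, c.2) := by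
      have : (fun y : Ω × S => (y.1, c.2)) = (fun ω => (ω, c.2)) ∘ Prod.fst := rfl
      simp only [m, List.length_nil, Nat.zero_lt_succ, if_true, (Nat.succ_ne_zero t).symm, if_false]
      rw [this, ← Measure.map_map (by fun_prop) measurable_fst, Measure.map_fst_prod]
      simp
    have hsub : ∀ (j : A) (i : List A), m (t + 1) (j :: i) = m t i := fun j i => by
      simp [m]
    have e : (fun p => cut c (t + 1) (unfoldTree k p)) =
        (fun (p : (Ω × S) × (A → List A → Ω × S)) (i : List A) =>
          (i.casesOn p.1 fun j i => p.2 j i : Ω × S)) ∘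
        Prod.map (fun ω => (ω, c.2)) (fun q j => cut c t (unfoldTree k (q j))) ∘
        fun p => ((k (p.1, p.2 [])).1, fun j => childSeed k j p) := by
      funext p i
      cases i <;> simp [cut, unfoldTree]
    have hc := (measurable_cut (A := A) c t).comp (measurable_unfoldTree hk)
    have hq : Measurable fun (q : A → S × (List A → I)) (j : A) => cut c t (unfoldTree k (q j)) :=
      measurable_pi_lambda _ fun j => hc.comp (measurable_pi_apply j)
    have hp : Measurable fun p : S × (List A → I) =>
        ((k (p.1, p.2 [])).1, fun j => childSeed k j p) :=
      (measurable_fst.comp (hk.comp (by fun_prop))).prodMk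
        (measurable_pi_lambda _ fun j => measurable_childSeed hk j)
    have hω : Measurable fun ω : Ω => (ω, c.2) := by fun_prop
    rw [e, ← Measure.map_map hglue ((hω.prodMap hq).comp hp), ← Measure.map_map (hω.prodMap hq) hp,
      map_noise_childSeed hk hkr, ← Measure.map_prod_map _ _ hω hq,
      Measure.infinitePi_map_pi (f := fun _ p => cut c t (unfoldTree k p)) _ fun _ => hc,
      ih, ← hroot, ← infinitePi_eq_map_root_subtrees (m (t + 1))]
    simp_rw [hsub]

/-- Almost surely, every state of the unfolded tree is computed from the states of its children. -/
theorem unfoldTree_recursion {Ω S : Type*} [MeasurableSpace Ω] [MeasurableSpace S]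
    {γ : RandomMap Ω S} {d : ℕ∞} {hd : ∀ ω, γ.arity ω ≤ d}
    {k : S × I → Ω × (ArgIndex d → S)} (hk : Measurable k) {r : ProbabilityMeasure Ω}
    {μ : ProbabilityMeasure S} (hkr : ((μ : Measure S).prod volume).map k =
      (r : Measure Ω).prod (Measure.infinitePi fun _ : ArgIndex d => (μ : Measure S)))
    (hkγ : ∀ᵐ p ∂(μ : Measure S).prod (volume : Measure I), p.1 = γ.full hd (k p).1 (k p).2)
    (i : TreeWord d) : ∀ᵐ p ∂seedLaw (ArgIndex d) μ, (unfoldTree k p i).2 =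
      γ.full hd (unfoldTree k p i).1 fun j => (unfoldTree k p (i ++ [j])).2 := by
  induction i with
  | nil =>
    have h1 : (seedLaw (ArgIndex d) μ).map (fun p => (p.1, p.2 [])) =
        (μ : Measure S).prod (volume : Measure I) := by
      have : (fun p : S × (TreeWord d → I) => (p.1, p.2 [])) = Prod.map id fun z => z [] := rfl
      rw [this, seedLaw, ← Measure.map_prod_map _ _ measurable_id (measurable_pi_apply _),
        Measure.infinitePi_map_eval, Measure.map_id]
    rw [← h1] at hkγ
    exact ae_of_ae_map (Measurable.aemeasurable (by fun_prop)) hkγ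
  | cons j i ih =>
    rw [← map_childSeed hk hkr j] at ih
    exact ae_of_ae_map (measurable_childSeed hk j).aemeasurable ih

/-- Maps that depend on the cut tree only have the same law under `P` and `Q` as soon as the cut
tree has. -/
theorem map_eq_map_of_comp_cut {A Ω S F : Type*} [MeasurableSpace Ω] [MeasurableSpace S]
    [MeasurableSpace F] {P Q : Measure (List A → Ω × S)} {c : Ω × S} {t : ℕ}
    (hP : P.map (cut c t) = Q.map (cut c t)) {φ : (List A → Ω × S) → F} (hφ : Measurable φ)
    (hφt : φ ∘ cut c t = φ) : P.map φ = Q.map φ := by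
  have h1 := congrArg (Measure.map φ) hP
  rwa [Measure.map_map hφ (measurable_cut c t), Measure.map_map hφ (measurable_cut c t),
    hφt] at h1

/-- If the noise above level `t` and the states at level `t` are independent with laws `r` and `μ`
for all `t`, and the recursion holds almost surely, then the coordinates form a recursive tree
process. -/
theorem isRecursiveTreeProcess_of_map_cut {Ω S : Type*} [MeasurableSpace Ω] [MeasurableSpace S]
    {γ : RandomMap Ω S} {r : ProbabilityMeasure Ω} {d : ℕ∞} {hd : ∀ ω, γ.arity ω ≤ d}
    {μ : ProbabilityMeasure S} {P : Measure (TreeWord d → Ω × S)} [IsProbabilityMeasure P]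
    (c : Ω × S) (hP : ∀ t, P.map (cut c t) =
      (Measure.infinitePi fun _ : TreeWord d => (r : Measure Ω).prod (μ : Measure S)).map (cut c t))
    (hrec : ∀ i : TreeWord d, ∀ᵐ x ∂P, (x i).2 =
      γ.full hd (x i).1 fun j => (x (i ++ [j])).2) :
    IsRecursiveTreeProcess γ r d hd μ P (fun i x => (x i).1) (fun i x => (x i).2) := by
  set Q := Measure.infinitePi fun _ : TreeWord d => (r : Measure Ω).prod (μ : Measure S) with hQ
  have hQr : Q.map (fun x i => (x i).1) =
      Measure.infinitePi fun _ : TreeWord d => (r : Measure Ω) := by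
    rw [hQ, Measure.infinitePi_map_pi _ fun _ => measurable_fst]
    simp
  have hQμ : Q.map (fun x i => (x i).2) =
      Measure.infinitePi fun _ : TreeWord d => (μ : Measure S) := by
    rw [hQ, Measure.infinitePi_map_pi _ fun _ => measurable_snd]
    simp
  have hWm : Measurable fun (x : TreeWord d → Ω × S) i => (x i).1 := by fun_prop
  have hXm : Measurable fun (x : TreeWord d → Ω × S) i => (x i).2 := by fun_prop
  have hW : ∀ i, P.map (fun x : TreeWord d → Ω × S => (x i).1) = r := by
    intro i
    rw [map_eq_map_of_comp_cut (hP (i.length + 1)) (by fun_prop) (by funext x; simp [cut])]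
    have h1 := congrArg (Measure.map fun z => z i) hQr
    rw [Measure.map_map (by fun_prop) hWm, Measure.infinitePi_map_eval] at h1
    exact h1
  have hX : ∀ i, P.map (fun x : TreeWord d → Ω × S => (x i).2) = μ := by
    intro i
    rw [map_eq_map_of_comp_cut (hP i.length) (by fun_prop) (by funext x; simp [cut])]
    have h1 := congrArg (Measure.map fun z => z i) hQμ
    rw [Measure.map_map (by fun_prop) hXm, Measure.infinitePi_map_eval] at h1
    exact h1
  have hWall : P.map (fun x i => (x i).1) =
      Measure.infinitePi fun _ : TreeWord d => (r : Measure Ω) := by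
    refine Measure.eq_infinitePi _ fun s B hB => ?_
    have hbox : MeasurableSet ((s : Set (TreeWord d)).pi B) :=
      MeasurableSet.pi (Finset.countable_toSet _) fun i _ => hB i
    -- a finite box does not see the noise at large levels
    obtain ⟨t, ht⟩ : ∃ t, ∀ i ∈ s, i.length < t :=
      ⟨s.sup List.length + 1, fun i hi => Nat.lt_succ_of_le (Finset.le_sup hi)⟩
    have hcut : cut c t ⁻¹' ((fun (x : TreeWord d → Ω × S) i => (x i).1) ⁻¹'
        (s : Set (TreeWord d)).pi B) =
        (fun (x : TreeWord d → Ω × S) i => (x i).1) ⁻¹' (s : Set (TreeWord d)).pi B := by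
      ext x
      simp only [Set.mem_preimage, Set.mem_pi]
      refine forall₂_congr fun i hi => ?_
      simp [cut, ht i hi]
    have h1 := congrArg (fun m => m ((fun (x : TreeWord d → Ω × S) i => (x i).1) ⁻¹'
        (s : Set (TreeWord d)).pi B)) (hP t)
    beta_reduce at h1
    rw [Measure.map_apply (measurable_cut c t) (hWm hbox),
      Measure.map_apply (measurable_cut c t) (hWm hbox), hcut] at h1
    rw [Measure.map_apply hWm hbox, h1, ← Measure.map_apply hWm hbox, hQr,
      Measure.infinitePi_pi _ fun i _ => hB i]
  have hXt : ∀ t, P.map (fun x (i : {i : TreeWord d // i.length = t}) => (x i).2) =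
      Measure.infinitePi fun _ : {i : TreeWord d // i.length = t} => (μ : Measure S) := by
    intro t
    rw [map_eq_map_of_comp_cut (hP t) (by fun_prop) (by funext x i; simp [cut, i.2]),
      ← Measure.map_infinitePi_infinitePi_of_inj (P := fun _ : TreeWord d => (μ : Measure S))
        (f := fun i : {i : TreeWord d // i.length = t} => (i : TreeWord d)) Subtype.val_injective,
      ← hQμ, Measure.map_map (by fun_prop) hXm]
    rfl
  refine ⟨fun i => by fun_prop, fun i => by fun_prop, ?_, hW, fun t _ => ?_, fun t _ i _ => hX i,
    fun t _ => ?_, hrec⟩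
  · rw [iIndepFun_iff_map_fun_eq_infinitePi_map fun i => by fun_prop, hWall]
    simp_rw [hW]
  · rw [iIndepFun_iff_map_fun_eq_infinitePi_map fun i => by fun_prop, hXt]
    simp_rw [hX]
  · have hu : Measurable fun (x : TreeWord d → Ω × S) (i : {i : TreeWord d // i.length = t}) =>
        (x i).2 := by fun_prop
    have hv : Measurable fun (x : TreeWord d → Ω × S) (i : {i : TreeWord d // i.length < t}) =>
        (x i).1 := by fun_prop
    have hind : IndepFun (fun (x : TreeWord d → Ω × S) i => (x i).2)
        (fun (x : TreeWord d → Ω × S) i => (x i).1) Q := by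
      refine IndepFun.symm ?_
      rw [indepFun_iff_map_prod_eq_prod_map_map hWm.aemeasurable hXm.aemeasurable, hQr, hQμ, hQ]
      exact infinitePi_prod_map_unzip _ _
    rw [indepFun_iff_map_prod_eq_prod_map_map hu.aemeasurable hv.aemeasurable,
      map_eq_map_of_comp_cut (hP t) (hu.prodMk hv) (by
        funext x
        refine Prod.ext ?_ ?_
        · funext i; simp [cut, i.2]
        · funext i; simp [cut, i.2]),
      map_eq_map_of_comp_cut (hP t) hu (by funext x i; simp [cut, i.2]),
      map_eq_map_of_comp_cut (hP t) hv (by funext x i; simp [cut, i.2])]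
    exact (indepFun_iff_map_prod_eq_prod_map_map hu.aemeasurable hv.aemeasurable).1
      (hind.comp (φ := fun (x : TreeWord d → S) (i : {i : TreeWord d // i.length = t}) => x i)
        (ψ := fun (w : TreeWord d → Ω) (i : {i : TreeWord d // i.length < t}) => w i)
        (by fun_prop) (by fun_prop))

theorem exists_isRecursiveTreeProcess {Ω S : Type*} [MeasurableSpace Ω] [StandardBorelSpace Ω]
    [MeasurableSpace S] [StandardBorelSpace S] (γ : RandomMap Ω S) (r : ProbabilityMeasure Ω)
    (d : ℕ∞) (hd : ∀ ω, γ.arity ω ≤ d) (μ : ProbabilityMeasure S) (hμ : γ.rdeMap r μ = μ) :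
    ∃ P : Measure (TreeWord d → Ω × S), IsProbabilityMeasure P ∧
      IsRecursiveTreeProcess γ r d hd μ P (fun i x => (x i).1) (fun i x => (x i).2) := by
  obtain ⟨ω₀⟩ : Nonempty Ω := (r : Measure Ω).nonempty_of_neZero
  obtain ⟨s₀⟩ : Nonempty S := (μ : Measure S).nonempty_of_neZero
  obtain ⟨k, hk, hkr, hkγ⟩ := exists_resolution γ r hd hμ
  have hZ := measurable_unfoldTree hk
  have hprob : IsProbabilityMeasure ((seedLaw (ArgIndex d) μ).map (unfoldTree k)) :=
    Measure.isProbabilityMeasure_map hZ.aemeasurable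
  refine ⟨_, hprob, isRecursiveTreeProcess_of_map_cut (ω₀, s₀) (fun t => ?_) fun i => ?_⟩
  · rw [Measure.map_map (measurable_cut _ t) hZ]
    exact map_cut_unfoldTree hk hkr _ t
  · have hF : Measurable fun x : TreeWord d → Ω × S =>
        γ.full hd (x i).1 fun j => (x (i ++ [j])).2 :=
      (γ.measurable_full hd).comp (f := fun x : TreeWord d → Ω × S =>
        ((x i).1, fun j : ArgIndex d => (x (i ++ [j])).2)) (by fun_prop)
    exact (ae_map_iff hZ.aemeasurable (measurableSet_eq_fun (by fun_prop) hF)).2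
      (unfoldTree_recursion hk hkr hkγ i)

end Existence

/-! ### The equivalences -/

theorem mainTheorem1 {Ω : Type*} {S : Type*}
    [TopologicalSpace Ω] [PolishSpace Ω] [MeasurableSpace Ω] [BorelSpace Ω]
    [TopologicalSpace S] [PolishSpace S] [MeasurableSpace S] [BorelSpace S]
    (γ : RandomMap Ω S) (r : ProbabilityMeasure Ω)
    (d : ℕ∞) (hd0 : 1 ≤ d) (hd : ∀ ω, γ.arity ω ≤ d)
    (μ : ProbabilityMeasure S) (hμ : γ.rdeMap r μ = μ) :
    -- a recursive tree process corresponding to `μ` exists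
    (∃ P : Measure (TreeWord d → Ω × S), IsProbabilityMeasure P ∧
      IsRecursiveTreeProcess γ r d hd μ P (fun i x => (x i).1) (fun i x => (x i).2)) ∧
    -- the limit `μ'` of the iterates started in `δ_μ` exists and has first moment measure `μ`
    ∃ μ' : ProbabilityMeasure (ProbabilityMeasure S),
      Tendsto (fun t : ℕ => (γ.higherMap r)^[t] (diracProba μ)) atTop (𝓝 μ') ∧
      firstMoment μ' = μ ∧
      -- the equivalences, for an arbitrary recursive tree process corresponding to `μ`
      ∀ {E : Type*} [MeasurableSpace E] (P : Measure E) [IsProbabilityMeasure P]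
        (W : TreeWord d → E → Ω) (X : TreeWord d → E → S),
        IsRecursiveTreeProcess γ r d hd μ P W X →
        List.TFAE [
          IsEndogenous P W X,
          μ' = diracLaw μ,
          ∀ ρ : ProbabilityMeasure (ProbabilityMeasure S), firstMoment ρ = μ →
            Tendsto (fun t : ℕ => (γ.higherMap r)^[t] ρ) atTop (𝓝 (diracLaw μ))] := by
  have : Nonempty S := (μ : Measure S).nonempty_of_neZero
  have := secondCountableTopology_probabilityMeasure (S := S)
  have hex := exists_isRecursiveTreeProcess γ r d hd μ hμ
  refine ⟨hex, ?_⟩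
  obtain ⟨P₀, hP₀, h₀⟩ := hex
  let ν : ProbabilityMeasure (ProbabilityMeasure S) :=
    ⟨P₀.map (rootLaw P₀ (fun i x => (x i).1) fun i x => (x i).2),
      Measure.isProbabilityMeasure_map h₀.measurable_rootLaw.aemeasurable⟩
  have hν := h₀.tendsto_iterate_higherMap (ν := ν) rfl
  refine ⟨ν, hν, h₀.firstMoment_law_rootLaw hμ rfl, fun {E} _ P _ W X h => ?_⟩
  -- the law of the conditional law of the root is the same for all recursive tree processes
  have hνP : P.map (rootLaw P W X) = ν := by
    let ν' : ProbabilityMeasure (ProbabilityMeasure S) :=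
      ⟨P.map (rootLaw P W X), Measure.isProbabilityMeasure_map h.measurable_rootLaw.aemeasurable⟩
    have hν' := h.tendsto_iterate_higherMap (ν := ν') rfl
    exact congrArg (fun m : ProbabilityMeasure (ProbabilityMeasure S) =>
      (m : Measure (ProbabilityMeasure S))) (tendsto_nhds_unique hν' hν)
  have hδ : firstMoment (diracProba μ) = μ :=
    Subtype.ext (Measure.dirac_bind measurable_subtype_coe μ)
  tfae_have 1 ↔ 2 := h.isEndogenous_iff_law_rootLaw hμ hνP
  tfae_have 2 → 3 := fun h2 ρ hρ => tendsto_diracLaw_of_sq_le (h2 ▸ hν)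
    (firstMoment_iterate_higherMap γ r hμ hρ) fun f t => sq_integral_iterate_le γ r hρ f t
  tfae_have 3 → 2 := fun h3 => tendsto_nhds_unique hν (h3 _ hδ)
  tfae_finish
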